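/- Let $p\in(1,\infty)$, let $X$ be a non-empty set, and let $(\mathcal E,\mathcal F)$ be a $p$-resistance form on $X$. That is, $\mathcal F$ is a linear subspace of $\mathbb R^X$ and $\mathcal E:\mathcal F\to[0,\infty)$ are such that: (RF1) $\mathcal F$ contains the constant functions, $\mathcal E^{1/p}$ is a seminorm on $\mathcal F$, and $\mathcal E(u)=0$ if and only if $u$ is constant; (RF2) $\mathcal F$ modulo constants, normed by $\mathcal E^{1/p}$, is a Banach space; (RF3) $\mathcal F$ separates the points of $X$; (RF4) $R_{\mathcal E}(x,y):=\sup\{|u(x)-u(y)|^p/\mathcal E(u) : u\in\mathcal F \text{ non-constant}\}<\infty$ for all $x,y\in X$ (with $\sup\emptyset:=0$); (RF5) (generalized $p$-contraction property) if $n_1,n_2\in\mathbb N=\{1,2,\dots\}$, $q_1\in(0,p]$, $q_2\in[p,\infty]$ and $T:\mathbb R^{n_1}\to\mathbb R^{n_2}$ satisfies $T(0)=0$ and $\|T(x)-T(y)\|_{\ell^{q_2}}\le\|x-y\|_{\ell^{q_1}}$ for all $x,y$, then for all $u=(u_1,\dots,u_{n_1})\in\mathcal F^{n_1}$ we have $T(u)\in\mathcal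 F^{n_2}$ and $\|(\mathcal E(T_l(u))^{1/p})_l\|_{\ell^{q_2}}\le\|(\mathcal E(u_k)^{1/p})_k\|_{\ell^{q_1}}$. Equip $X$ with the topology induced by the metric $R_{\mathcal E}^{1/p}$ and with its Borel $\sigma$-algebra $\mathcal B(X)$. Put $\widehat R_p:=R_{\mathcal E}^{1/(p-1)}$ and $B(x,s):=\{y\in X:\widehat R_p(x,y)<s\}$, and let $\operatorname{supp}[\varphi]$ be the closure of $\{\varphi\ne0\}$. For $f,g\in\mathcal F$ put $\mathcal E(f;g):=\frac1p\frac{d}{dt}\mathcal E(f+tg)|_{t=0}$. A function $h\in\mathcal F$ is called $\mathcal E$-superharmonic on $U\subseteq X$ if $\mathcal E(-h;\varphi)\le0$ for every $\varphi\in\mathcal F$ with $\varphi\ge0$ on $X$ and $\varphi=0$ on $X\setminus U$. Let $\{\Gamma\langle f\rangle\}_{f\in\mathcal F}$ be a family of measures on $(X,\mathcal B(X))$ such that $\Gamma\langle f\rangle(X)\le\mathcal E(f)$ for all $f\in\mathcal F$, such that $\Gamma\langle\cdot\rangle(A)^{1/p}$ is a seminorm on $\mathcal F$ for every $A\in\mathcal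 B(X)$, and which satisfies $p$-Clarkson's inequality: for all $f,g\in\mathcal F$ and $A\in\mathcal B(X)$, the quantity $\Gamma\langle f+g\rangle(A)+\Gamma\langle f-g\rangle(A)$ is at least $2\bigl(\Gamma\langle f\rangle(A)^{1/(p-1)}+\Gamma\langle g\rangle(A)^{1/(p-1)}\bigr)^{p-1}$ if $p\le2$, and at most this number if $p\ge2$. Let $\Gamma\langle f;g\rangle$ be the signed measure $A\mapsto\frac1p\frac{d}{dt}\Gamma\langle f+tg\rangle(A)|_{t=0}$. Assume that there exist $\Upsilon:X\times(0,\infty)\to(0,\infty)$ and constants $A_1\ge1$, $A_2>1$, $C\in(0,\infty)$ such that: (i) $\Upsilon(x,2s)\le C\,\Upsilon(x,s)$ for all $(x,s)\in X\times(0,\infty)$; (ii) for all $(x,s)\in X\times(0,\infty)$ and all $u\in\mathcal F$, $$\sup_{y,z\in B(x,s)}|u(y)-u(z)|^p\le C\,\Upsilon(x,s)^{-1}\,\Gamma\langle u\rangle\bigl(B(x,A_1s)\bigr);$$ (iii) for all $(x,s)\in X\times(0,\infty)$ with $B(x,A_2s)\ne X$, $$\inf\{\mathcal E(\varphi):\varphi\in\mathcal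 F,\ \varphi=1\text{ on }B(x,s),\ \operatorname{supp}[\varphi]\subseteq B(x,A_2s)\}\le C\,\Upsilon(x,s)\qquad(\inf\emptyset:=\infty);$$ (iv) (chain rule (CL2)) for all $n\in\mathbb N$, $u\in\mathcal F$, $v=(v_1,\dots,v_n)\in\mathcal F^n$, $\Phi\in C^1(\mathbb R)$ and $\Psi\in C^1(\mathbb R^n)$, we have $\Phi(u),\Psi(v)\in\mathcal F$ and $$d\Gamma\langle\Phi(u);\Psi(v)\rangle=\sum_{k=1}^n\operatorname{sgn}(\Phi'(u))\,|\Phi'(u)|^{p-1}\,\partial_k\Psi(v)\,d\Gamma\langle u;v_k\rangle.$$ Then there exist $C_{\mathrm H}\in(0,\infty)$ and $\delta_{\mathrm H}\in(0,1)$ such that for every $(x,s)\in X\times(0,\infty)$ with $B(x,\delta_{\mathrm H}^{-1}s)\ne X$ and every $u\in\mathcal F$ such that $u\ge0$ on $X$, $u$ is $\mathcal E$-superharmonic on $B(x,\delta_{\mathrm H}^{-1}s)$ and $\Gamma\langle u\rangle(X)=\mathcal E(u)$, $$\sup_{B(x,s)}u\le C_{\mathrm H}\inf_{B(x,s)}u.$$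 -/

import Mathlib

open MeasureTheory
open scoped ENNReal

namespace PResistance

noncomputable section

/-! ### Functionals on a linear space of functions -/

/-- `(E, F)` is a `p`-energy form: `E` is non-negative and `E ^ (1 / p)` is a seminorm on `F`. -/
def IsEnergyForm {V : Type*} [AddCommGroup V] [Module ℝ V] (p : ℝ) (E : V → ℝ) : Prop :=
  (∀ u, 0 ≤ E u) ∧ ∃ q : Seminorm ℝ V, ∀ u, q u = E u ^ (1 / p)

/-- `p`-Clarkson's inequality. -/
def Clarkson {V : Type*} [AddCommGroup V] [Module ℝ V] (p : ℝ) (E : V → ℝ) : Prop :=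
  (p ≤ 2 → ∀ f g : V, 2 * (E f ^ (1 / (p - 1)) + E g ^ (1 / (p - 1))) ^ (p - 1)
      ≤ E (f + g) + E (f - g)) ∧
  (2 ≤ p → ∀ f g : V, E (f + g) + E (f - g)
      ≤ 2 * (E f ^ (1 / (p - 1)) + E g ^ (1 / (p - 1))) ^ (p - 1))

/-- The two-variable version `E(f; g) = (1 / p) * d/dt E(f + t g)` at `t = 0`. The derivative
exists whenever `E` is a `p`-energy form satisfying `p`-Clarkson's inequality. -/
def crossForm {V : Type*} [AddCommGroup V] [Module ℝ V] (p : ℝ) (E : V → ℝ) (f g : V) : ℝ :=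
  1 / p * deriv (fun t : ℝ => E (f + t • g)) 0

variable {X : Type*} {F : Submodule ℝ (X → ℝ)}

/-- The generalized `p`-contraction property. The norm of `WithLp.toLp q x` is the `ℓ^q`
(quasi-)norm `(∑ k, |x k| ^ q) ^ (1 / q)`, and the maximum norm for `q = ∞`. -/
def GeneralizedContraction (p : ℝ) (E : F → ℝ) : Prop :=
  ∀ (n₁ n₂ : ℕ) (q₁ q₂ : ℝ≥0∞), 0 < n₁ → 0 < n₂ →
    0 < q₁ → q₁ ≤ ENNReal.ofReal p → ENNReal.ofReal p ≤ q₂ →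
    ∀ T : (Fin n₁ → ℝ) → (Fin n₂ → ℝ), T 0 = 0 →
      (∀ x y, ‖WithLp.toLp q₂ (T x - T y)‖ ≤ ‖WithLp.toLp q₁ (x - y)‖) →
      ∀ u : Fin n₁ → F,
        ∃ hT : ∀ l, (fun x => T (fun k => (u k : X → ℝ) x) l) ∈ F,
          ‖WithLp.toLp q₂ (fun l => E ⟨_, hT l⟩ ^ (1 / p))‖
            ≤ ‖WithLp.toLp q₁ (fun k => E (u k) ^ (1 / p))‖

/-- The values `|u(x) - u(y)|^p / E(u)` for the non-constant `u ∈ F`. -/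
def resistanceSet (p : ℝ) (E : F → ℝ) (x y : X) : Set ℝ :=
  {r | ∃ u : F, (∀ c : ℝ, (u : X → ℝ) ≠ fun _ => c) ∧
    r = |(u : X → ℝ) x - (u : X → ℝ) y| ^ p / E u}

/-- `R(x, y)`: the supremum of `|u(x) - u(y)|^p / E(u)` over the non-constant `u ∈ F`
(equal to `0` if there is no such `u`). -/
def resistance (p : ℝ) (E : F → ℝ) (x y : X) : ℝ :=
  sSup (resistanceSet p E x y)

/-- `(E, F)` is a `p`-resistance form on `X`. -/
structure IsResistanceForm (p : ℝ) (E : F → ℝ) : Prop where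
  /-- `F` contains the constants. -/
  const_mem : ∀ c : ℝ, (fun _ => c) ∈ F
  /-- `E ^ (1 / p)` is a seminorm. -/
  isEnergyForm : IsEnergyForm p E
  /-- The kernel of `E` consists precisely of the constants. -/
  eq_zero_iff : ∀ u : F, E u = 0 ↔ ∃ c : ℝ, (u : X → ℝ) = fun _ => c
  /-- `F` modulo constants, normed by `E ^ (1 / p)`, is a Banach space: every Cauchy sequence
  converges. -/
  complete : ∀ u : ℕ → F,
    (∀ ε : ℝ, 0 < ε → ∃ N, ∀ m ≥ N, ∀ n ≥ N, E (u m - u n) ^ (1 / p) < ε) →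
    ∃ v : F, ∀ ε : ℝ, 0 < ε → ∃ N, ∀ n ≥ N, E (u n - v) ^ (1 / p) < ε
  /-- `F` separates points. -/
  separates : ∀ x y : X, x ≠ y → ∃ u : F, (u : X → ℝ) x ≠ (u : X → ℝ) y
  /-- `R(x, y) < ∞`. -/
  resistance_finite : ∀ x y : X, BddAbove (resistanceSet p E x y)
  /-- The generalized `p`-contraction property. -/
  contraction : GeneralizedContraction p E

/-- The topology on `X` induced by the metric `R ^ (1 / p)`. -/
@[reducible]
def resistanceTopology (p : ℝ) (E : F → ℝ) : TopologicalSpace X where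
  IsOpen U := ∀ x ∈ U, ∃ ε : ℝ, 0 < ε ∧ ∀ y, resistance p E x y ^ (1 / p) < ε → y ∈ U
  isOpen_univ := fun _ _ => ⟨1, one_pos, fun _ _ => trivial⟩
  isOpen_inter := by
    intro U V hU hV x hx
    obtain ⟨a, ha, hUa⟩ := hU x hx.1
    obtain ⟨b, hb, hVb⟩ := hV x hx.2
    exact ⟨min a b, lt_min ha hb, fun y hy =>
      ⟨hUa y (hy.trans_le (min_le_left _ _)), hVb y (hy.trans_le (min_le_right _ _))⟩⟩
  isOpen_sUnion := by
    intro S hS x hx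
    obtain ⟨U, hU, hxU⟩ := hx
    obtain ⟨a, ha, h⟩ := hS U hU x hxU
    exact ⟨a, ha, fun y hy => ⟨U, hU, h y hy⟩⟩

/-- The Borel `σ`-algebra of the topology induced by `R ^ (1 / p)`. -/
abbrev resistanceBorel (p : ℝ) (E : F → ℝ) : MeasurableSpace X :=
  @borel X (resistanceTopology p E)

/-- The `p`-resistance metric `R ^ (1 / (p - 1))`. -/
def resistanceMetric (p : ℝ) (E : F → ℝ) (x y : X) : ℝ :=
  resistance p E x y ^ (1 / (p - 1))

/-- The open ball of the `p`-resistance metric. -/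
def resistanceBall (p : ℝ) (E : F → ℝ) (x : X) (s : ℝ) : Set X :=
  {y | resistanceMetric p E x y < s}

/-- The support of a function: the closure of the set where it does not vanish, in the topology
induced by `R ^ (1 / p)`. -/
def resistanceSupport (p : ℝ) (E : F → ℝ) (u : X → ℝ) : Set X :=
  @closure X (resistanceTopology p E) {x | u x ≠ 0}

/-- `h ∈ F` is `E`-subharmonic on `U`. -/
def IsSubharmonicOn (p : ℝ) (E : F → ℝ) (h : F) (U : Set X) : Prop :=
  ∀ φ : F, (∀ x, x ∉ U → (φ : X → ℝ) x = 0) → (∀ x, 0 ≤ (φ : X → ℝ) x) → crossForm p E h φ ≤ 0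

/-- `h ∈ F` is `E`-superharmonic on `U`. -/
def IsSuperharmonicOn (p : ℝ) (E : F → ℝ) (h : F) (U : Set X) : Prop :=
  IsSubharmonicOn p E (-h) U

/-- The infimum of `E(φ)` over the `φ ∈ F` that are `1` on the ball of radius `s` about `x` and
whose support is included in the ball of radius `r` about `x` (it is `∞` if there is no such `φ`). -/
def ballCapacity (p : ℝ) (E : F → ℝ) (x : X) (s r : ℝ) : ℝ≥0∞ :=
  ⨅ φ ∈ {φ : F | (∀ y ∈ resistanceBall p E x s, (φ : X → ℝ) y = 1) ∧
      resistanceSupport p E φ ⊆ resistanceBall p E x r}, ENNReal.ofReal (E φ)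

/-! ### Energy measures -/

/-- `Γ` is a family of `p`-energy measures dominated by `(E, F)`. -/
structure IsEnergyMeasureFamily {_mX : MeasurableSpace X} (p : ℝ) (E : F → ℝ)
    (Γ : F → Measure X) : Prop where
  /-- The total mass of `Γ⟨f⟩` is at most `E(f)`. -/
  dominated : ∀ f : F, Γ f Set.univ ≤ ENNReal.ofReal (E f)
  /-- `Γ⟨·⟩(A) ^ (1 / p)` is a seminorm. -/
  isEnergyForm : ∀ A : Set X, MeasurableSet A → IsEnergyForm p (fun f => (Γ f).real A)

/-- `p`-Clarkson's inequality for a family of measures. -/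
def MeasureClarkson {_mX : MeasurableSpace X} (p : ℝ) (Γ : F → Measure X) : Prop :=
  ∀ A : Set X, MeasurableSet A → Clarkson p (fun f => (Γ f).real A)

open Classical in
/-- The signed measure `Γ⟨f; g⟩`, with `Γ⟨f; g⟩(A) = (1 / p) * d/dt Γ⟨f + t g⟩(A)` at `t = 0` for
all measurable `A`. For `p`-energy measures satisfying `p`-Clarkson's inequality, these
derivatives exist and form a signed measure, so that the alternative `0` does not occur. -/
def mutualMeasure {_mX : MeasurableSpace X} (p : ℝ) (Γ : F → Measure X) (f g : F) :
    SignedMeasure X :=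
  if h : ∃ ν : SignedMeasure X, ∀ A : Set X, MeasurableSet A →
      ν A = crossForm p (fun u => (Γ u).real A) f g
  then h.choose else 0

/-- The chain rule: for all `u, v₁, …, vₙ ∈ F`, `Φ ∈ C¹(ℝ)` and `Ψ ∈ C¹(ℝⁿ)`, the functions `Φ(u)`
and `Ψ(v)` belong to `F`, and
`dΓ⟨Φ(u); Ψ(v)⟩ = ∑ k, sgn(Φ'(u)) |Φ'(u)|^(p - 1) ∂ₖΨ(v) dΓ⟨u; vₖ⟩`. -/
def ChainRule {_mX : MeasurableSpace X} (p : ℝ) (Γ : F → Measure X) : Prop :=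
  ∀ (n : ℕ), 0 < n → ∀ (u : F) (v : Fin n → F) (Φ : ℝ → ℝ) (Ψ : (Fin n → ℝ) → ℝ),
    ContDiff ℝ 1 Φ → ContDiff ℝ 1 Ψ →
    ∃ (hΦ : (fun x => Φ ((u : X → ℝ) x)) ∈ F) (hΨ : (fun x => Ψ (fun k => (v k : X → ℝ) x)) ∈ F),
      ∀ A : Set X, MeasurableSet A →
        mutualMeasure p Γ ⟨_, hΦ⟩ ⟨_, hΨ⟩ A =
          ∑ k, ∫ᵛ x in A, (Real.sign (deriv Φ ((u : X → ℝ) x)) *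
              |deriv Φ ((u : X → ℝ) x)| ^ (p - 1) *
              fderiv ℝ Ψ (fun j => (v j : X → ℝ) x) (Pi.single k 1))
            ∂•(mutualMeasure p Γ u (v k))

end

end PResistance

/-! This is Moser's logarithmic argument, in a setting where an energy estimate bounds oscillations
pointwise, so no iteration is needed. For ε > 0 put l = log(u + ε), and let φ be a cutoff function
between two balls. Testing superharmonicity of u with φ^p (u + ε)^(1 - p) and expanding by the chain
rule gives (p - 1) ∫ φ^p dΓ⟨l⟩ ≤ p ∫ φ^(p - 1) dΓ⟨l; φ⟩. Hölder and Young absorb half of the left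
side, leaving ∫ φ^p dΓ⟨l⟩ ≤ 2^p / (p - 1) E(φ) (`integral_log_le`). The capacity bound makes E(φ) at
most a multiple of Υ(x, s), and the two-point estimate for l has the factor Υ(x, s)⁻¹. Hence log(u +
ε) oscillates on B(x, s) by at most a constant independent of u, x, s and ε; exponentiate and let ε
→ 0.

Superharmonicity concerns E, whereas the chain rule concerns Γ. Since Γ⟨f⟩(X) ≤ E(f) with equality
at f = u, the two forms have the same derivative at u (`crossForm_eq_of_le`), provided both are
differentiable. For Γ this follows from Clarkson's inequality (`Clarkson.differentiableAt`), for E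
from the generalized contraction property (`IsResistanceForm.differentiableAt`). -/

namespace PResistance

open Set Filter Topology

/-! ### Differentiability and two-variable forms of p-energy forms -/

section EnergyForm

variable {V : Type*} [AddCommGroup V] [Module ℝ V] {p : ℝ} {N M : V → ℝ}

theorem IsEnergyForm.exists_seminorm (hN : IsEnergyForm p N) (hp : 1 < p) :
    ∃ q : Seminorm ℝ V, (∀ u, q u = N u ^ (1 / p)) ∧ ∀ u, N u = q u ^ p := by
  obtain ⟨h0, q, hq⟩ := hN
  refine ⟨q, hq, fun u => ?_⟩
  rw [hq, ← Real.rpow_mul (h0 u), one_div_mul_cancel (by linarith), Real.rpow_one]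

theorem IsEnergyForm.smul (hN : IsEnergyForm p N) (hp : 1 < p) (c : ℝ) (u : V) :
    N (c • u) = |c| ^ p * N u := by
  obtain ⟨q, -, hq⟩ := hN.exists_seminorm hp
  rw [hq, hq, map_smul_eq_mul, Real.mul_rpow (norm_nonneg _) (apply_nonneg _ _), Real.norm_eq_abs]

theorem IsEnergyForm.neg (hN : IsEnergyForm p N) (hp : 1 < p) (u : V) : N (-u) = N u := by
  obtain ⟨q, -, hq⟩ := hN.exists_seminorm hp
  rw [hq, hq, map_neg_eq_map]

theorem IsEnergyForm.add_of_eq_zero (hN : IsEnergyForm p N) (hp : 1 < p) {u c : V}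
    (hc : N c = 0) : N (u + c) = N u := by
  obtain ⟨q, hq', hq⟩ := hN.exists_seminorm hp
  have hc0 : q c = 0 := by
    rw [hq', hc, Real.zero_rpow (one_div_ne_zero (by linarith))]
  rw [hq, hq]
  congr 1
  refine le_antisymm ((map_add_le_add q u c).trans_eq (by rw [hc0, add_zero])) ?_
  have h := map_sub_le_add q (u + c) c
  rwa [add_sub_cancel_right, hc0, add_zero] at h

theorem IsEnergyForm.convexOn (hN : IsEnergyForm p N) (hp : 1 < p) (f g : V) :
    ConvexOn ℝ univ fun t : ℝ => N (f + t • g) := by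
  obtain ⟨q, -, hq⟩ := hN.exists_seminorm hp
  have h1 : ConvexOn ℝ univ fun t : ℝ => q (f + t • g) := by
    refine ⟨convex_univ, fun s _ t _ a b ha hb hab => ?_⟩
    have : f + (a • s + b • t) • g = a • (f + s • g) + b • (f + t • g) := by
      rw [smul_add, smul_add, add_add_add_comm, ← add_smul, hab, one_smul, add_smul, smul_assoc,
        smul_assoc]
    simp only [this]
    refine (map_add_le_add q _ _).trans_eq ?_
    rw [map_smul_eq_mul, map_smul_eq_mul, Real.norm_of_nonneg ha, Real.norm_of_nonneg hb,
      smul_eq_mul, smul_eq_mul]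
  refine ⟨convex_univ, fun s hs t ht a b ha hb hab => ?_⟩
  simp only [hq]
  refine (Real.rpow_le_rpow (apply_nonneg _ _) (h1.2 hs ht ha hb hab) (by linarith)).trans ?_
  exact (convexOn_rpow hp.le).2 (apply_nonneg q (f + s • g)) (apply_nonneg q (f + t • g)) ha hb hab

/-- A convex function whose symmetric second difference at `0` is bounded above by a function with
vanishing derivative is differentiable at `0`. -/
theorem differentiableAt_zero_of_convexOn {h k : ℝ → ℝ} (hh : ConvexOn ℝ univ h)
    (hk : HasDerivAt k 0 0) (hk0 : k 0 = 2 * h 0) (hle : ∀ t, h t + h (-t) ≤ k t) :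
    DifferentiableAt ℝ h 0 := by
  have hr := hh.differentiableWithinAt_Ioi_of_mem_interior (x := 0) (by simp)
  have hl := hh.differentiableWithinAt_Iio_of_mem_interior (x := 0) (by simp)
  set a := derivWithin h (Ioi 0) 0
  set b := derivWithin h (Iio 0) 0
  have hr' : HasDerivWithinAt h a (Ioi 0) 0 := hr.hasDerivWithinAt
  have hl' : HasDerivWithinAt h b (Iio 0) 0 := hl.hasDerivWithinAt
  -- Convexity orders the one-sided derivatives; the bound on the second difference gives the
  -- reverse inequality.
  have hba : b ≤ a := hh.leftDeriv_le_rightDeriv_of_mem_interior (by simp)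
  have hneg : HasDerivWithinAt (fun t => h (-t)) (-b) (Ioi 0) 0 := by
    have h1 : HasDerivWithinAt h b (Iio 0) (-0) := by simpa using hl'
    have h2 := h1.scomp (0 : ℝ) (hasDerivAt_neg (0 : ℝ)).hasDerivWithinAt (s := Ioi 0)
      (fun t ht => by simpa using ht)
    simpa [Function.comp_def] using h2
  have hd : HasDerivWithinAt (fun t => k t - (h t + h (-t))) (0 - (a + -b)) (Ioi 0) 0 :=
    hk.hasDerivWithinAt.sub (hr'.add hneg)
  have hnn : 0 ≤ 0 - (a + -b) := by
    have ht := (hasDerivWithinAt_iff_tendsto_slope' (by simp)).1 hd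
    refine ge_of_tendsto ht ?_
    filter_upwards [self_mem_nhdsWithin] with t ht
    rw [slope_def_field, neg_zero, hk0]
    have := hle t
    have ht' : (0 : ℝ) < t := ht
    apply div_nonneg <;> linarith
  have hab : a = b := by linarith
  rw [← hab] at hl'
  have := (hr'.Ici_of_Ioi).union (hl'.Iic_of_Iio)
  rw [Ici_union_Iic] at this
  exact (hasDerivWithinAt_univ.1 this).differentiableAt

theorem hasDerivAt_abs_rpow_zero {r : ℝ} (hr : 1 < r) : HasDerivAt (fun t : ℝ => |t| ^ r) 0 0 := by
  simpa using hasDerivAt_abs_rpow 0 hr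

/-- With t • g in place of g, the second difference is at most 2 |t|^p N(g), which is o(t) because p
> 1. -/
theorem IsEnergyForm.differentiableAt_of_le_two (hN : IsEnergyForm p N) (hp : 1 < p)
    (h : ∀ f g, N (f + g) + N (f - g) ≤ 2 * (N f + N g)) (f g : V) :
    DifferentiableAt ℝ (fun t : ℝ => N (f + t • g)) 0 := by
  refine differentiableAt_zero_of_convexOn (k := fun t => 2 * (N f + |t| ^ p * N g))
    (hN.convexOn hp f g) ?_ ?_ fun t => ?_
  · simpa using (((hasDerivAt_abs_rpow_zero hp).mul_const (N g)).const_add (N f)).const_mul 2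
  · simp [Real.zero_rpow (by linarith : p ≠ 0)]
  · have := h f (t • g)
    rw [hN.smul hp] at this
    simpa [sub_eq_add_neg] using this

/-- If `N(f + g) + N(f - g)` is bounded by `2 (N(f)^a + K N(g)^a)^b`, where `b ≥ 1` and `p a > 1`,
then `N` is differentiable along lines. -/
theorem IsEnergyForm.differentiableAt_of_rpow (hN : IsEnergyForm p N) (hp : 1 < p) {a b K : ℝ}
    (ha : 1 < p * a) (hb : 1 ≤ b) (hab : a * b = 1)
    (h : ∀ f g, N (f + g) + N (f - g) ≤ 2 * (N f ^ a + K * N g ^ a) ^ b) (f g : V) :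
    DifferentiableAt ℝ (fun t : ℝ => N (f + t • g)) 0 := by
  refine differentiableAt_zero_of_convexOn
    (k := fun t => 2 * (N f ^ a + |t| ^ (p * a) * (K * N g ^ a)) ^ b)
    (hN.convexOn hp f g) ?_ ?_ fun t => ?_
  · have h1 := ((hasDerivAt_abs_rpow_zero ha).mul_const (K * N g ^ a)).const_add (N f ^ a)
    simpa using (h1.rpow_const (p := b) (Or.inr hb)).const_mul 2
  · simp [Real.zero_rpow (by linarith : p * a ≠ 0), ← Real.rpow_mul (hN.1 f), hab]
  · have := h f (t • g)
    rw [hN.smul hp, Real.mul_rpow (by positivity) (hN.1 g), ← Real.rpow_mul (abs_nonneg t)] at this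
    simp only [sub_eq_add_neg] at this
    convert this using 2
    · simp
    · ring_nf

theorem Clarkson.differentiableAt (hC : Clarkson p N) (hN : IsEnergyForm p N) (hp : 1 < p)
    (f g : V) : DifferentiableAt ℝ (fun t : ℝ => N (f + t • g)) 0 := by
  rcases le_total p 2 with h2 | h2
  · refine hN.differentiableAt_of_le_two hp (fun f g => ?_) f g
    -- For p ≤ 2 Clarkson's inequality is a lower bound; applied to f + g and f - g, whose sum and
    -- difference are 2f and 2g, it becomes an upper bound, simplified by concavity of t ↦ t^(p -
    -- 1).
    have h := hC.1 h2 (f + g) (f - g)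
    have e1 : f + g + (f - g) = (2 : ℝ) • f := by rw [two_smul]; abel
    have e2 : f + g - (f - g) = (2 : ℝ) • g := by rw [two_smul]; abel
    rw [e1, e2, hN.smul hp, hN.smul hp] at h
    have ha := hN.1 (f + g)
    have hb := hN.1 (f - g)
    have hne : p - 1 ≠ 0 := by linarith
    set x := N (f + g) ^ (1 / (p - 1))
    set y := N (f - g) ^ (1 / (p - 1))
    have hx : x ^ (p - 1) = N (f + g) := by
      rw [← Real.rpow_mul ha, one_div_mul_cancel hne, Real.rpow_one]
    have hy : y ^ (p - 1) = N (f - g) := by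
      rw [← Real.rpow_mul hb, one_div_mul_cancel hne, Real.rpow_one]
    have hx0 : 0 ≤ x := Real.rpow_nonneg ha _
    have hy0 : 0 ≤ y := Real.rpow_nonneg hb _
    have hconc := (Real.concaveOn_rpow (p := p - 1) (by linarith) (by linarith)).2 hx0 hy0
      (by norm_num : (0 : ℝ) ≤ 1 / 2) (by norm_num : (0 : ℝ) ≤ 1 / 2) (by norm_num)
    simp only [smul_eq_mul, hx, hy] at hconc
    have e3 : 1 / 2 * x + 1 / 2 * y = (1 / 2) * (x + y) := by ring
    rw [e3, Real.mul_rpow (by norm_num) (by positivity)] at hconc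
    have e4 : (2 : ℝ) ^ p * ((1 / 2 : ℝ) ^ (p - 1)) = 2 := by
      rw [one_div, Real.inv_rpow (by norm_num), ← Real.rpow_neg (by norm_num),
        ← Real.rpow_add (by norm_num)]
      norm_num
    have h2p : (0 : ℝ) < 2 ^ p := by positivity
    rw [abs_two] at h
    have h5 : (2 : ℝ) ^ p * (1 / 2 * (N (f + g) + N (f - g))) ≤ 2 * (x + y) ^ (p - 1) := by
      calc _ ≤ (2 : ℝ) ^ p * ((1 / 2) ^ (p - 1) * (x + y) ^ (p - 1)) := by
            exact mul_le_mul_of_nonneg_left (by linarith only [hconc]) h2p.le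
        _ = _ := by rw [← mul_assoc, e4]
    have h6 := h5.trans h
    rw [← mul_add] at h6
    have := le_of_mul_le_mul_left h6 h2p
    linarith
  · refine hN.differentiableAt_of_rpow hp (a := 1 / (p - 1)) (b := p - 1) (K := 1) ?_ (by linarith)
      (one_div_mul_cancel (by linarith)) (fun f g => by rw [one_mul]; exact hC.2 h2 f g) f g
    rw [mul_one_div, lt_div_iff₀ (by linarith)]
    linarith

theorem crossForm_self (hN : IsEnergyForm p N) (hp : 1 < p) (f : V) :
    crossForm p N f f = N f := by
  have h1 : (fun t : ℝ => N (f + t • f)) = fun t => |1 + t| ^ p * N f := by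
    ext t
    rw [← hN.smul hp, add_smul, one_smul]
  have h2 : HasDerivAt (fun t : ℝ => |1 + t| ^ p * N f) (p * N f) 0 := by
    have := ((hasDerivAt_abs_rpow (1 + 0) hp).comp_const_add 1 0).mul_const (N f)
    simpa using this
  rw [crossForm, h1, h2.deriv]
  field_simp

theorem crossForm_neg_left (hN : IsEnergyForm p N) (hp : 1 < p) (f g : V) :
    crossForm p N (-f) g = -crossForm p N f g := by
  have h1 : (fun t : ℝ => N (-f + t • g)) = fun t => (fun s : ℝ => N (f + s • g)) (-t) := by
    ext t
    rw [← hN.neg hp]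
    congr 1
    rw [neg_add, neg_neg, neg_smul]
  rw [crossForm, crossForm, h1, deriv_comp_neg (fun s : ℝ => N (f + s • g)) 0]
  simp

theorem crossForm_add_left_of_eq_zero (hN : IsEnergyForm p N) (hp : 1 < p) {f g c : V}
    (hc : N c = 0) : crossForm p N (f + c) g = crossForm p N f g := by
  have h1 : (fun t : ℝ => N (f + c + t • g)) = fun t => N (f + t • g) := by
    ext t
    rw [add_right_comm, hN.add_of_eq_zero hp hc]
  rw [crossForm, crossForm, h1]

/-- Along the line f + t g the difference M - N is non-negative and vanishes at t = 0, so its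
derivative there is zero. -/
theorem crossForm_eq_of_le (hle : ∀ u, N u ≤ M u) {f g : V} (hf : N f = M f)
    (hdN : DifferentiableAt ℝ (fun t : ℝ => N (f + t • g)) 0)
    (hdM : DifferentiableAt ℝ (fun t : ℝ => M (f + t • g)) 0) :
    crossForm p N f g = crossForm p M f g := by
  have hmin : IsLocalMin (fun t : ℝ => M (f + t • g) - N (f + t • g)) 0 :=
    Eventually.of_forall fun t => by simp [hf, hle]
  have h := hmin.deriv_eq_zero
  rw [deriv_fun_sub hdM hdN, sub_eq_zero] at h
  rw [crossForm, crossForm, h]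

/-- The Hölder-type bound for the two-variable form. -/
theorem abs_crossForm_le (hN : IsEnergyForm p N) (hp : 1 < p) {f g : V}
    (hd : DifferentiableAt ℝ (fun t : ℝ => N (f + t • g)) 0) :
    |crossForm p N f g| ≤ N f ^ ((p - 1) / p) * N g ^ (1 / p) := by
  obtain ⟨q, hq', hq⟩ := hN.exists_seminorm hp
  have hp0 : 0 < p := by linarith
  have hqf : N f ^ ((p - 1) / p) = q f ^ (p - 1) := by
    rw [hq' f, ← Real.rpow_mul (hN.1 f)]
    ring_nf
  rw [hqf, ← hq' g]
  set D := deriv (fun t : ℝ => N (f + t • g)) 0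
  have hD : HasDerivAt (fun t : ℝ => N (f + t • g)) D 0 := hd.hasDerivAt
  -- For t > 0 the triangle inequality gives N(f + σ t g) ≤ (q(f) + t q(g))^p, with equality at t =
  -- 0; compare the right derivatives. The signs σ = ±1 give both halves of the absolute value.
  have bound : ∀ σ : ℝ, |σ| = 1 → σ * D ≤ p * q f ^ (p - 1) * q g := by
    intro σ hσ
    have h1 : HasDerivAt (fun t : ℝ => (q f + t * q g) ^ p) (p * q f ^ (p - 1) * q g) 0 := by
      have := (((hasDerivAt_id (0 : ℝ)).mul_const (q g)).const_add (q f)).rpow_const (p := p)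
        (Or.inr hp.le)
      simp only [id, zero_mul, add_zero, one_mul] at this
      convert this using 1
      ring
    have h2 : HasDerivAt (fun t : ℝ => N (f + (σ * t) • g)) (σ * D) 0 := by
      have h3 : HasDerivAt (fun t : ℝ => N (f + t • g)) D (σ * 0) := by simpa using hD
      have := h3.comp (0 : ℝ) ((hasDerivAt_id (0 : ℝ)).const_mul σ)
      simpa [Function.comp_def, mul_comm] using this
    have h3 := (h1.sub h2).hasDerivWithinAt (s := Ioi 0)
    have ht := (hasDerivWithinAt_iff_tendsto_slope' (by simp)).1 h3
    refine sub_nonneg.1 (ge_of_tendsto ht ?_)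
    filter_upwards [self_mem_nhdsWithin] with t ht
    have ht' : (0 : ℝ) < t := ht
    have hle : N (f + (σ * t) • g) ≤ (q f + t * q g) ^ p := by
      rw [hq]
      refine Real.rpow_le_rpow (apply_nonneg _ _) ?_ hp0.le
      refine (map_add_le_add q _ _).trans_eq ?_
      rw [map_smul_eq_mul, Real.norm_eq_abs, abs_mul, hσ, one_mul, abs_of_pos ht']
    rw [slope_def_field]
    simp only [Pi.sub_apply, zero_mul, add_zero, mul_zero, zero_smul, sub_zero]
    rw [← hq f, sub_self, sub_zero]
    exact div_nonneg (sub_nonneg.2 hle) ht'.le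
  have h1 := bound 1 (by simp)
  have h2 := bound (-1) (by simp)
  rw [crossForm, abs_mul, abs_of_pos (by positivity : 0 < 1 / p)]
  have h3 : |D| ≤ p * (q f ^ (p - 1) * q g) := by
    rw [abs_le]
    constructor <;> linarith
  calc 1 / p * |D| ≤ 1 / p * (p * (q f ^ (p - 1) * q g)) := by gcongr
    _ = _ := by field_simp

end EnergyForm

/-! ### Hölder's inequality for signed measures -/

theorem simpleFunc_comp_eq_sum {X : Type*} [MeasurableSpace X] (s : SimpleFunc X ℝ) (g : ℝ → ℝ)
    (x : X) : g (s x) = ∑ c ∈ s.range, (s ⁻¹' {c}).indicator (fun _ => g c) x := by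
  rw [Finset.sum_eq_single (s x)]
  · simp
  · intro c _ hc
    exact indicator_of_notMem (fun h => hc (by simpa using h.symm)) _
  · intro h
    exact absurd (s.mem_range_self x) h

section Holder

variable {X : Type*} [MeasurableSpace X] {ν : SignedMeasure X} {μ₁ μ₂ : Measure X}
  [IsFiniteMeasure μ₁] [IsFiniteMeasure μ₂] {q p : ℝ}

/-- Finite variation is what makes bounded measurable functions integrable against ν. -/
theorem isFiniteMeasure_variation_of_le
    (hν : ∀ A, MeasurableSet A → |ν A| ≤ μ₁.real A + μ₂.real A) :
    IsFiniteMeasure ν.variation := by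
  refine isFiniteMeasure_of_le (μ₁ + μ₂) (VectorMeasure.variation_le_of_forall_enorm_le ?_)
  intro A hA
  rw [Real.enorm_eq_ofReal_abs, Measure.add_apply]
  refine (ENNReal.ofReal_le_ofReal (hν A hA)).trans_eq ?_
  rw [ENNReal.ofReal_add measureReal_nonneg measureReal_nonneg, ofReal_measureReal,
    ofReal_measureReal]

theorem rpow_mul_rpow_le_add (h : q.HolderConjugate p) {a b : ℝ} (ha : 0 ≤ a) (hb : 0 ≤ b) :
    a ^ (1 / q) * b ^ (1 / p) ≤ a + b := by
  have hq0 := h.pos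
  have hp0 := h.symm.pos
  have h1 := Real.geom_mean_le_arith_mean2_weighted (by positivity : 0 ≤ 1 / q)
    (by positivity : 0 ≤ 1 / p) ha hb (by rw [one_div, one_div]; exact h.inv_add_inv_eq_one)
  have h2 : 1 / q ≤ 1 := (div_le_one hq0).2 h.lt.le
  have h3 : 1 / p ≤ 1 := (div_le_one hp0).2 h.symm.lt.le
  have h4 := mul_le_mul_of_nonneg_right h2 ha
  have h5 := mul_le_mul_of_nonneg_right h3 hb
  linarith

/-- Apply the set-wise bound on each level set of s, then the discrete Hölder inequality to the sum
over the values. -/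
theorem abs_integral_simpleFunc_le (h : q.HolderConjugate p)
    (hν : ∀ A, MeasurableSet A → |ν A| ≤ μ₁.real A ^ (1 / q) * μ₂.real A ^ (1 / p))
    (s : SimpleFunc X ℝ) :
    |∫ᵛ x, s x ∂•ν| ≤ (∫ x, |s x| ^ q ∂μ₁) ^ (1 / q) * μ₂.real univ ^ (1 / p) := by
  have hq0 := h.pos
  have hp0 := h.symm.pos
  have : IsFiniteMeasure ν.variation := isFiniteMeasure_variation_of_le fun A hA =>
    (hν A hA).trans (rpow_mul_rpow_le_add h measureReal_nonneg measureReal_nonneg)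
  have hm : ∀ c, MeasurableSet (s ⁻¹' {c}) := fun c => s.measurableSet_fiber c
  have e1 : ∫ᵛ x, s x ∂•ν = ∑ c ∈ s.range, c * ν (s ⁻¹' {c}) := by
    have h1 : (fun x => s x) =
        fun x => ∑ c ∈ s.range, (s ⁻¹' {c}).indicator (fun _ => c) x := by
      ext x
      exact simpleFunc_comp_eq_sum s id x
    rw [h1, VectorMeasure.integral_finsetSum]
    · refine Finset.sum_congr rfl fun c _ => ?_
      rw [VectorMeasure.integral_indicator_const _ (hm c)]
      simp
    · intro c _
      exact (integrable_const c).indicator (hm c)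
  have e2 : ∫ x, |s x| ^ q ∂μ₁ = ∑ c ∈ s.range, |c| ^ q * μ₁.real (s ⁻¹' {c}) := by
    have h1 : (fun x => |s x| ^ q) =
        fun x => ∑ c ∈ s.range, (s ⁻¹' {c}).indicator (fun _ => |c| ^ q) x := by
      ext x
      exact simpleFunc_comp_eq_sum s (fun c => |c| ^ q) x
    rw [h1, integral_finsetSum]
    · refine Finset.sum_congr rfl fun c _ => ?_
      rw [integral_indicator_const _ (hm c), smul_eq_mul, mul_comm]
    · intro c _
      exact (integrable_const _).indicator (hm c)
  have e3 : μ₂.real univ = ∑ c ∈ s.range, μ₂.real (s ⁻¹' {c}) := by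
    rw [← measureReal_biUnion_finset]
    · congr 1
      ext x
      simp
    · intro a _ b _ hab
      exact (disjoint_singleton.2 hab).preimage _
    · intro c _
      exact hm c
  rw [e1, e2, e3]
  calc |∑ c ∈ s.range, c * ν (s ⁻¹' {c})|
      ≤ ∑ c ∈ s.range, |c| * (μ₁.real (s ⁻¹' {c}) ^ (1 / q) * μ₂.real (s ⁻¹' {c}) ^ (1 / p)) := by
        refine (Finset.abs_sum_le_sum_abs _ _).trans (Finset.sum_le_sum fun c _ => ?_)
        rw [abs_mul]
        exact mul_le_mul_of_nonneg_left (hν _ (hm c)) (abs_nonneg c)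
    _ = ∑ c ∈ s.range, (|c| * μ₁.real (s ⁻¹' {c}) ^ (1 / q)) * μ₂.real (s ⁻¹' {c}) ^ (1 / p) := by
        simp only [mul_assoc]
    _ ≤ (∑ c ∈ s.range, (|c| * μ₁.real (s ⁻¹' {c}) ^ (1 / q)) ^ q) ^ (1 / q) *
          (∑ c ∈ s.range, (μ₂.real (s ⁻¹' {c}) ^ (1 / p)) ^ p) ^ (1 / p) :=
        Real.inner_le_Lp_mul_Lq_of_nonneg _ h (fun c _ => by positivity) fun c _ => by positivity
    _ = _ := by
        have e4 : ∀ c : ℝ, (|c| * μ₁.real (s ⁻¹' {c}) ^ (1 / q)) ^ q =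
            |c| ^ q * μ₁.real (s ⁻¹' {c}) := fun c => by
          rw [Real.mul_rpow (abs_nonneg c) (by positivity), ← Real.rpow_mul measureReal_nonneg,
            one_div_mul_cancel hq0.ne', Real.rpow_one]
        have e5 : ∀ c : ℝ, (μ₂.real (s ⁻¹' {c}) ^ (1 / p)) ^ p = μ₂.real (s ⁻¹' {c}) := fun c => by
          rw [← Real.rpow_mul measureReal_nonneg, one_div_mul_cancel hp0.ne', Real.rpow_one]
        simp only [e4, e5]

/-- Hölder's inequality for a signed measure which is dominated by a geometric mean of two
finite measures. -/
theorem abs_integral_le_of_holder (h : q.HolderConjugate p)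
    (hν : ∀ A, MeasurableSet A → |ν A| ≤ μ₁.real A ^ (1 / q) * μ₂.real A ^ (1 / p))
    {a : X → ℝ} (ha : Measurable a) {K : ℝ} (hK : ∀ x, |a x| ≤ K) :
    |∫ᵛ x, a x ∂•ν| ≤ (∫ x, |a x| ^ q ∂μ₁) ^ (1 / q) * μ₂.real univ ^ (1 / p) := by
  have hq0 := h.pos
  have : IsFiniteMeasure ν.variation := isFiniteMeasure_variation_of_le fun A hA =>
    (hν A hA).trans (rpow_mul_rpow_le_add h measureReal_nonneg measureReal_nonneg)
  have hs := ha.stronglyMeasurable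
  have hK0 : 0 ≤ |K| := abs_nonneg K
  have hb : ∀ n x, ‖hs.approxBounded |K| n x‖ ≤ |K| := fun n x => hs.norm_approxBounded_le hK0 n x
  have hlim : ∀ x, Tendsto (fun n => hs.approxBounded |K| n x) atTop (𝓝 (a x)) := fun x =>
    hs.tendsto_approxBounded_of_norm_le ((hK x).trans (le_abs_self K))
  have t1 : Tendsto (fun n => ∫ᵛ x, hs.approxBounded |K| n x ∂•ν) atTop (𝓝 (∫ᵛ x, a x ∂•ν)) :=
    VectorMeasure.tendsto_integral_of_dominated_convergence (fun _ => |K|)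
      (fun n => (hs.approxBounded |K| n).stronglyMeasurable.aestronglyMeasurable) (integrable_const _)
      (fun n => Eventually.of_forall (hb n)) (Eventually.of_forall hlim)
  have t2 : Tendsto (fun n => ∫ x, |hs.approxBounded |K| n x| ^ q ∂μ₁) atTop
      (𝓝 (∫ x, |a x| ^ q ∂μ₁)) := by
    refine tendsto_integral_of_dominated_convergence (fun _ => |K| ^ q)
      (fun n => ?_) (integrable_const _) (fun n => Eventually.of_forall fun x => ?_)
      (Eventually.of_forall fun x => ?_)
    · exact (((hs.approxBounded |K| n).measurable.norm).pow_const q).aestronglyMeasurable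
    · rw [Real.norm_of_nonneg (by positivity)]
      exact Real.rpow_le_rpow (abs_nonneg _) (hb n x) hq0.le
    · exact ((hlim x).abs).rpow_const (Or.inr hq0.le)
  refine le_of_tendsto_of_tendsto' t1.abs
    ((t2.rpow_const (Or.inr (by positivity))).mul_const _) fun n => ?_
  exact abs_integral_simpleFunc_le h hν _

end Holder

/-! ### Mutual energy measures -/

section EnergyMeasure

variable {X : Type*} [MeasurableSpace X] {F : Submodule ℝ (X → ℝ)} {p : ℝ} {E : F → ℝ}
  {Γ : F → Measure X}

theorem IsEnergyMeasureFamily.isFiniteMeasure (hΓ : IsEnergyMeasureFamily p E Γ) (f : F) :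
    IsFiniteMeasure (Γ f) :=
  ⟨(hΓ.dominated f).trans_lt ENNReal.ofReal_lt_top⟩

theorem IsEnergyMeasureFamily.differentiableAt (hΓ : IsEnergyMeasureFamily p E Γ)
    (hC : MeasureClarkson p Γ) (hp : 1 < p) {A : Set X} (hA : MeasurableSet A) (f g : F) :
    DifferentiableAt ℝ (fun t : ℝ => (Γ (f + t • g)).real A) 0 :=
  (hC A hA).differentiableAt (hΓ.isEnergyForm A hA) hp f g

theorem holderConjugate_div_sub_one (hp : 1 < p) : (p / (p - 1)).HolderConjugate p :=
  (Real.HolderConjugate.conjExponent hp).symm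

theorem IsEnergyMeasureFamily.abs_crossForm_le (hΓ : IsEnergyMeasureFamily p E Γ)
    (hC : MeasureClarkson p Γ) (hp : 1 < p) {A : Set X} (hA : MeasurableSet A) (f g : F) :
    |crossForm p (fun u => (Γ u).real A) f g| ≤
      (Γ f).real A ^ (1 / (p / (p - 1))) * (Γ g).real A ^ (1 / p) := by
  rw [one_div_div]
  exact PResistance.abs_crossForm_le (hΓ.isEnergyForm A hA) hp (hΓ.differentiableAt hC hp hA f g)

/-- The derivative is finitely additive in A because each Γ⟨f + t g⟩ is a measure. Being dominated
by the finite measure Γ⟨f⟩ + Γ⟨g⟩, it is countably additive, so the default value 0 in the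
definition is not taken. -/
theorem IsEnergyMeasureFamily.mutualMeasure_apply (hΓ : IsEnergyMeasureFamily p E Γ)
    (hC : MeasureClarkson p Γ) (hp : 1 < p) (f g : F) {A : Set X} (hA : MeasurableSet A) :
    mutualMeasure p Γ f g A = crossForm p (fun u => (Γ u).real A) f g := by
  classical
  have hfin := hΓ.isFiniteMeasure
  let m : Set X → ℝ := fun A =>
    if MeasurableSet A then crossForm p (fun u => (Γ u).real A) f g else 0
  have hm : ∀ A, ‖m A‖ₑ ≤ (Γ f + Γ g) A := by
    intro A
    by_cases hA : MeasurableSet A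
    · have h1 := (hΓ.abs_crossForm_le hC hp hA f g).trans
        (rpow_mul_rpow_le_add (holderConjugate_div_sub_one hp) measureReal_nonneg
          measureReal_nonneg)
      simp only [m, hA, if_true]
      rw [Real.enorm_eq_ofReal_abs, Measure.add_apply]
      refine (ENNReal.ofReal_le_ofReal h1).trans_eq ?_
      rw [ENNReal.ofReal_add measureReal_nonneg measureReal_nonneg, ofReal_measureReal,
        ofReal_measureReal]
    · simp [m, hA]
  have hadd : ∀ s t, MeasurableSet s → MeasurableSet t → Disjoint s t →
      m (s ∪ t) = m s + m t := by
    intro s t hs ht hst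
    simp only [m, hs, ht, hs.union ht, if_true, crossForm]
    rw [← mul_add, ← deriv_fun_add (hΓ.differentiableAt hC hp hs f g)
      (hΓ.differentiableAt hC hp ht f g)]
    congr 3
    ext r
    exact measureReal_union hst ht
  have hex : ∃ ν : SignedMeasure X, ∀ A : Set X, MeasurableSet A →
      ν A = crossForm p (fun u => (Γ u).real A) f g := by
    refine ⟨VectorMeasure.of_additive_of_le_measure m hm hadd fun s hs => by simp [m, hs],
      fun A hA => ?_⟩
    change m A = _
    simp [m, hA]
  rw [mutualMeasure, dif_pos hex]
  exact hex.choose_spec A hA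

theorem IsEnergyMeasureFamily.abs_mutualMeasure_le (hΓ : IsEnergyMeasureFamily p E Γ)
    (hC : MeasureClarkson p Γ) (hp : 1 < p) (f g : F) (A : Set X) (hA : MeasurableSet A) :
    |mutualMeasure p Γ f g A| ≤
      (Γ f).real A ^ (1 / (p / (p - 1))) * (Γ g).real A ^ (1 / p) := by
  rw [hΓ.mutualMeasure_apply hC hp f g hA]
  exact hΓ.abs_crossForm_le hC hp hA f g

theorem IsEnergyMeasureFamily.integral_mutualMeasure_self (hΓ : IsEnergyMeasureFamily p E Γ)
    (hC : MeasureClarkson p Γ) (hp : 1 < p) (f : F) (a : X → ℝ) :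
    ∫ᵛ x, a x ∂•(mutualMeasure p Γ f f) = ∫ x, a x ∂(Γ f) := by
  have := hΓ.isFiniteMeasure f
  have h1 : mutualMeasure p Γ f f = (Γ f).toSignedMeasure := by
    ext A hA
    rw [hΓ.mutualMeasure_apply hC hp f f hA, crossForm_self (hΓ.isEnergyForm A hA) hp,
      Measure.toSignedMeasure_apply_measurable hA]
  rw [h1, ← VectorMeasure.integral_toSignedMeasure]
  congr 1
  ext
  simp

/-- A Young-type bound for the integral of a bounded function with respect to `Γ⟨f; g⟩`. -/
theorem IsEnergyMeasureFamily.integral_mutualMeasure_le (hΓ : IsEnergyMeasureFamily p E Γ)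
    (hC : MeasureClarkson p Γ) (hp : 1 < p) (f g : F) {φ : X → ℝ} (hφ : Measurable φ)
    (h0 : ∀ x, 0 ≤ φ x) (h1 : ∀ x, φ x ≤ 1) :
    p * ∫ᵛ x, φ x ^ (p - 1) ∂•(mutualMeasure p Γ f g) ≤
      (p - 1) / 2 * ∫ x, φ x ^ p ∂(Γ f) + 2 ^ (p - 1) * (Γ g).real univ := by
  have hfin := hΓ.isFiniteMeasure
  have hp0 : 0 < p := by linarith
  have hp1 : 0 < p - 1 := by linarith
  have hH := abs_integral_le_of_holder (holderConjugate_div_sub_one hp)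
    (hΓ.abs_mutualMeasure_le hC hp f g) (hφ.pow_const (p - 1)) (K := 1) (fun x => by
      rw [abs_of_nonneg (Real.rpow_nonneg (h0 x) _)]
      exact Real.rpow_le_one (h0 x) (h1 x) hp1.le)
  have e1 : ∀ x, |φ x ^ (p - 1)| ^ (p / (p - 1)) = φ x ^ p := by
    intro x
    rw [abs_of_nonneg (Real.rpow_nonneg (h0 x) _), ← Real.rpow_mul (h0 x),
      mul_div_cancel₀ _ hp1.ne']
  simp only [e1] at hH
  set I := ∫ x, φ x ^ p ∂(Γ f)
  set G := (Γ g).real univ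
  have hI : 0 ≤ I := integral_nonneg fun x => Real.rpow_nonneg (h0 x) _
  have hG : 0 ≤ G := measureReal_nonneg
  set r := p / (p - 1) with hr
  have hr0 : 0 < r := by positivity
  -- The weights 1/2 and 2 are chosen so that after multiplication by p the first term is (p - 1)/2
  -- · I, half of what the Caccioppoli argument can absorb.
  have hY := Real.young_inequality_of_nonneg
    (a := (I / 2) ^ (1 / r)) (b := 2 ^ (1 / r) * G ^ (1 / p))
    (by positivity) (by positivity) (holderConjugate_div_sub_one hp)
  rw [← hr] at hY
  have e2 : (I / 2) ^ (1 / r) * (2 ^ (1 / r) * G ^ (1 / p)) = I ^ (1 / r) * G ^ (1 / p) := by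
    rw [← mul_assoc, ← Real.mul_rpow (by positivity) (by norm_num)]
    norm_num
  have e3 : ((I / 2) ^ (1 / r)) ^ r = I / 2 := by
    rw [← Real.rpow_mul (by positivity), one_div_mul_cancel hr0.ne', Real.rpow_one]
  have e4 : ((2 : ℝ) ^ (1 / r) * G ^ (1 / p)) ^ p = 2 ^ (p - 1) * G := by
    rw [Real.mul_rpow (by positivity) (by positivity), ← Real.rpow_mul (by norm_num),
      ← Real.rpow_mul hG, one_div_mul_cancel hp0.ne', Real.rpow_one, hr]
    congr 2
    field_simp
  rw [e2, e3, e4] at hY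
  have h2 := ((le_abs_self _).trans hH).trans hY
  calc _ ≤ p * (I / 2 / r + 2 ^ (p - 1) * G / p) := by gcongr
    _ = _ := by
      rw [hr]
      field_simp

end EnergyMeasure

/-! ### Two-point inequalities for real numbers -/

section Scalar

variable {p : ℝ}

/-- Concavity of t ↦ t^(p/2) at the squares (a ± b)², whose mean is a² + b², followed by
subadditivity of the same power. -/
theorem abs_add_rpow_add_abs_sub_rpow_le (hp : 0 < p) (h2 : p ≤ 2) (a b : ℝ) :
    |a + b| ^ p + |a - b| ^ p ≤ 2 * (|a| ^ p + |b| ^ p) := by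
  have hsq : ∀ x : ℝ, (x ^ 2) ^ (p / 2) = |x| ^ p := fun x => by
    rw [← sq_abs, ← Real.rpow_natCast, ← Real.rpow_mul (abs_nonneg x)]
    congr 1
    push_cast
    ring
  have hconc := (Real.concaveOn_rpow (p := p / 2) (by linarith) (by linarith)).2
    (sq_nonneg (a + b)) (sq_nonneg (a - b))
    (by norm_num : (0 : ℝ) ≤ 1 / 2) (by norm_num : (0 : ℝ) ≤ 1 / 2) (by norm_num)
  simp only [smul_eq_mul, hsq] at hconc
  have e : 1 / 2 * (a + b) ^ 2 + 1 / 2 * (a - b) ^ 2 = a ^ 2 + b ^ 2 := by ring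
  rw [e] at hconc
  have hsub := Real.rpow_add_le_add_rpow (sq_nonneg a) (sq_nonneg b)
    (by linarith : 0 ≤ p / 2) (by linarith : p / 2 ≤ 1)
  rw [hsq, hsq] at hsub
  linarith

/-- For |y| ≤ 1 the left side is at most 2 cosh(p y) ≤ 2 exp(p y²)^(p/2), and convexity of exp on
[0, p] bounds exp(p y²) by 1 + exp(p) y². For |y| ≥ 1 the crude bound |1 ± y| ≤ 2|y| suffices,
whence the 4. -/
theorem abs_one_add_rpow_add_abs_one_sub_rpow_le (h2 : 2 ≤ p) (y : ℝ) :
    |1 + y| ^ p + |1 - y| ^ p ≤ 2 * (1 + (Real.exp p + 4) * y ^ 2) ^ (p / 2) := by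
  have hp0 : 0 ≤ p := by linarith
  have hK : 0 < Real.exp p := Real.exp_pos p
  rcases le_total |y| 1 with hy | hy
  · have hy' := abs_le.1 hy
    have hexp : ∀ z : ℝ, 0 ≤ 1 + z → |1 + z| ^ p ≤ Real.exp (p * z) := fun z hz => by
      rw [abs_of_nonneg hz, mul_comm, Real.exp_mul]
      exact Real.rpow_le_rpow hz (by linarith [Real.add_one_le_exp z]) hp0
    have h1 := hexp y (by linarith)
    have h3 := hexp (-y) (by linarith)
    rw [← sub_eq_add_neg, mul_neg] at h3
    have h4 := Real.cosh_le_exp_half_sq (p * y)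
    rw [Real.cosh_eq] at h4
    have h5 : Real.exp ((p * y) ^ 2 / 2) = Real.exp (p * y ^ 2) ^ (p / 2) := by
      rw [← Real.exp_mul]
      ring_nf
    have hy2 : y ^ 2 ≤ 1 := by
      rw [← sq_abs]
      exact pow_le_one₀ (abs_nonneg y) hy
    have h6 := convexOn_exp.2 (mem_univ 0) (mem_univ p) (sub_nonneg.2 hy2) (sq_nonneg y) (by ring)
    simp only [smul_eq_mul, mul_zero, zero_add, Real.exp_zero, mul_one] at h6
    have h7 : Real.exp (p * y ^ 2) ≤ 1 + (Real.exp p + 4) * y ^ 2 := by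
      rw [mul_comm]
      nlinarith [sq_nonneg y]
    have h8 := Real.rpow_le_rpow (Real.exp_pos _).le h7 (by linarith : 0 ≤ p / 2)
    linarith
  · have hb : ∀ z : ℝ, |z| = |y| → |1 + z| ^ p ≤ (1 + (Real.exp p + 4) * y ^ 2) ^ (p / 2) := by
      intro z hz
      have h1 : |1 + z| ≤ 2 * |y| := by
        refine (abs_add_le 1 z).trans ?_
        rw [abs_one, hz]
        linarith
      have h3 : |1 + z| ^ p = (|1 + z| ^ 2) ^ (p / 2) := by
        rw [← Real.rpow_natCast, ← Real.rpow_mul (abs_nonneg _)]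
        congr 1
        push_cast
        ring
      rw [h3]
      refine Real.rpow_le_rpow (sq_nonneg _) ?_ (by linarith)
      have h4 : |1 + z| ^ 2 ≤ (2 * |y|) ^ 2 := pow_le_pow_left₀ (abs_nonneg _) h1 2
      rw [mul_pow, sq_abs y] at h4
      nlinarith [sq_nonneg y]
    have h1 := hb y rfl
    have h3 := hb (-y) (abs_neg y)
    rw [← sub_eq_add_neg] at h3
    linarith

theorem exists_abs_add_rpow_le (h2 : 2 ≤ p) :
    ∃ κ : ℝ, 0 < κ ∧ ∀ a b : ℝ,
      |a + κ * b| ^ p + |a - κ * b| ^ p ≤ 2 * (|a| ^ (2 : ℝ) + |b| ^ (2 : ℝ)) ^ (p / 2) := by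
  have hK : 1 ≤ Real.exp p + 4 := by linarith [Real.exp_pos p]
  have hK0 : 0 < Real.exp p + 4 := by linarith
  have hp0 : 0 < p := by linarith
  -- Scaling b by κ normalizes the constant of the previous inequality to 1; for a ≠ 0 divide by
  -- |a|^p and set y = κ b / a.
  refine ⟨(√(Real.exp p + 4))⁻¹, by positivity, fun a b => ?_⟩
  set κ := (√(Real.exp p + 4))⁻¹ with hκ
  have hκ2 : (Real.exp p + 4) * κ ^ 2 = 1 := by
    rw [hκ, inv_pow, Real.sq_sqrt hK0.le, mul_inv_cancel₀ hK0.ne']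
  have hsq : ∀ x : ℝ, (|x| ^ (2 : ℝ)) = x ^ 2 := fun x => by
    rw [Real.rpow_two, sq_abs]
  rw [hsq, hsq]
  rcases eq_or_ne a 0 with rfl | ha
  · have h1 : |κ * b| ^ p ≤ (b ^ 2) ^ (p / 2) := by
      have h3 : |κ * b| ^ p = (|κ * b| ^ 2) ^ (p / 2) := by
        rw [← Real.rpow_natCast, ← Real.rpow_mul (abs_nonneg _)]
        congr 1
        push_cast
        ring
      rw [h3]
      refine Real.rpow_le_rpow (sq_nonneg _) ?_ (by linarith)
      rw [sq_abs, mul_pow]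
      have : κ ^ 2 ≤ 1 := by nlinarith [sq_nonneg κ]
      nlinarith [sq_nonneg b]
    simp only [zero_add, zero_sub, abs_neg, ne_eq, OfNat.ofNat_ne_zero, not_false_eq_true, zero_pow]
    linarith
  · have h1 := abs_one_add_rpow_add_abs_one_sub_rpow_le h2 (κ * b / a)
    have ha2 : 0 < a ^ 2 := by positivity
    have h3 : (1 + (Real.exp p + 4) * (κ * b / a) ^ 2) = (a ^ 2 + b ^ 2) / a ^ 2 := by
      rw [div_pow, mul_pow, ← mul_div_assoc, ← mul_assoc, hκ2]
      field_simp
    have h4 : (a ^ 2) ^ (p / 2) = |a| ^ p := by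
      rw [← sq_abs, ← Real.rpow_natCast, ← Real.rpow_mul (abs_nonneg a)]
      congr 1
      push_cast
      ring
    have h5 : ∀ z : ℝ, |1 + z / a| ^ p = |a + z| ^ p / |a| ^ p := fun z => by
      rw [← Real.div_rpow (abs_nonneg _) (abs_nonneg _), ← abs_div, add_div, div_self ha]
    have h6 := h5 (κ * b)
    have h7 := h5 (-(κ * b))
    rw [neg_div, ← sub_eq_add_neg, ← sub_eq_add_neg] at h7
    have hap : 0 < |a| ^ p := by positivity
    rw [h3, Real.div_rpow (by positivity) ha2.le, h4, h6, h7, ← add_div, ← mul_div_assoc,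
      div_le_div_iff_of_pos_right hap] at h1
    exact h1

theorem norm_toLp_ofReal {n : ℕ} {q : ℝ} (hq : 0 < q) (v : Fin n → ℝ) :
    ‖WithLp.toLp (ENNReal.ofReal q) v‖ = (∑ i, |v i| ^ q) ^ (1 / q) := by
  rw [PiLp.norm_eq_sum (by rwa [ENNReal.toReal_ofReal hq.le]), ENNReal.toReal_ofReal hq.le]
  simp only [Real.norm_eq_abs]

end Scalar

/-! ### Contractions, differentiability and measurability for resistance forms -/

section ResistanceForm

variable {X : Type*} {F : Submodule ℝ (X → ℝ)} {p : ℝ} {E : F → ℝ}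

theorem IsResistanceForm.energy_rpow (hE : IsResistanceForm p E) (hp : 1 < p) (u : F) :
    |E u ^ (1 / p)| ^ p = E u := by
  have h0 := hE.isEnergyForm.1 u
  rw [abs_of_nonneg (Real.rpow_nonneg h0 _), ← Real.rpow_mul h0, one_div_mul_cancel (by linarith),
    Real.rpow_one]

/-- Normal contractions operate on a `p`-resistance form. -/
theorem IsResistanceForm.exists_comp (hE : IsResistanceForm p E) (hp : 1 < p) {τ : ℝ → ℝ}
    (h0 : τ 0 = 0) (hτ : ∀ a b, |τ a - τ b| ≤ |a - b|) (u : F) :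
    ∃ h : (fun x => τ ((u : X → ℝ) x)) ∈ F, E ⟨_, h⟩ ≤ E u := by
  have hp0 : 0 < p := by linarith
  obtain ⟨h, hle⟩ := hE.contraction 1 1 (ENNReal.ofReal p) (ENNReal.ofReal p) one_pos one_pos
    (ENNReal.ofReal_pos.2 hp0) le_rfl le_rfl (fun v _ => τ (v 0)) (by ext; simp [h0])
    (fun x y => by
      rw [norm_toLp_ofReal hp0, norm_toLp_ofReal hp0]
      simp only [Finset.univ_unique, Finset.sum_singleton, Pi.sub_apply]
      exact Real.rpow_le_rpow (by positivity)
        (Real.rpow_le_rpow (abs_nonneg _) (hτ _ _) hp0.le) (by positivity)) (fun _ => u)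
  refine ⟨h 0, ?_⟩
  rw [norm_toLp_ofReal hp0, norm_toLp_ofReal hp0] at hle
  simp only [hE.energy_rpow hp, Finset.univ_unique, Finset.sum_singleton] at hle
  exact (Real.rpow_le_rpow_iff (hE.isEnergyForm.1 _) (hE.isEnergyForm.1 _) (by positivity)).1 hle

/-- The unit contraction operates on a `p`-resistance form. -/
theorem IsResistanceForm.exists_truncation (hE : IsResistanceForm p E) (hp : 1 < p) (u : F) :
    ∃ v : F, (∀ x, (v : X → ℝ) x = min (max ((u : X → ℝ) x) 0) 1) ∧ E v ≤ E u := by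
  obtain ⟨h, hle⟩ := hE.exists_comp hp (τ := fun t => min (max t 0) 1) (by simp)
    (fun a b => (abs_min_sub_min_le_max _ _ _ _).trans (by
      rw [sub_self, abs_zero, max_eq_left (abs_nonneg _)]
      refine (abs_max_sub_max_le_max _ _ _ _).trans ?_
      rw [sub_self, abs_zero, max_eq_left (abs_nonneg _)])) u
  exact ⟨⟨_, h⟩, fun _ => rfl, hle⟩

theorem abs_log_sub_log_le {ε a b : ℝ} (hε : 0 < ε) (ha : ε ≤ a) (hb : ε ≤ b) :
    ε * |Real.log a - Real.log b| ≤ |a - b| := by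
  wlog hab : b ≤ a generalizing a b
  · rw [abs_sub_comm, abs_sub_comm a]
    exact this hb ha (le_of_not_ge hab)
  have hb0 : 0 < b := hε.trans_le hb
  have ha0 : 0 < a := hε.trans_le ha
  rw [abs_of_nonneg (sub_nonneg.2 (Real.log_le_log hb0 hab)), abs_of_nonneg (sub_nonneg.2 hab),
    ← Real.log_div ha0.ne' hb0.ne']
  have h1 := Real.log_le_sub_one_of_pos (div_pos ha0 hb0)
  have h2 : 0 ≤ Real.log (a / b) := Real.log_nonneg ((one_le_div hb0).2 hab)
  calc ε * Real.log (a / b) ≤ b * (a / b - 1) := mul_le_mul hb h1 h2 hb0.le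
    _ = a - b := by field_simp

/-- The logarithm is not C¹ on ℝ, so the chain rule does not apply to it directly. But log is
(1/ε)-Lipschitz on [ε, ∞): rescaled, shifted to vanish at 0 and frozen on the negative axis, it is a
normal contraction. -/
theorem IsResistanceForm.exists_log (hE : IsResistanceForm p E) (hp : 1 < p) (u : F)
    (hu : ∀ x, 0 ≤ (u : X → ℝ) x) {ε : ℝ} (hε : 0 < ε) :
    ∃ l : F, ∀ x, (l : X → ℝ) x = Real.log ((u : X → ℝ) x + ε) := by
  obtain ⟨h, -⟩ := hE.exists_comp hp
    (τ := fun t => ε * (Real.log (max t 0 + ε) - Real.log ε)) (by simp)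
    (fun a b => by
      rw [← mul_sub, sub_sub_sub_cancel_right, abs_mul, abs_of_pos hε]
      refine (abs_log_sub_log_le hε (by simp) (by simp)).trans ?_
      rw [add_sub_add_right_eq_sub]
      refine (abs_max_sub_max_le_max _ _ _ _).trans ?_
      rw [sub_self, abs_zero, max_eq_left (abs_nonneg _)]) u
  refine ⟨ε⁻¹ • ⟨_, h⟩ + ⟨_, hE.const_mem (Real.log ε)⟩, fun x => ?_⟩
  simp [max_eq_left (hu x), hε.ne']

/-- A scalar two-point inequality says that the linear map (a, b) ↦ 2^(-1/p) (a + κ b, a - κ b)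
contracts ℓ^q into ℓ^p; the contraction property transfers it to energies. -/
theorem IsResistanceForm.add_add_sub_le (hE : IsResistanceForm p E) (hp : 1 < p) {q κ : ℝ}
    (hq : 0 < q) (hqp : q ≤ p)
    (h : ∀ a b : ℝ, |a + κ * b| ^ p + |a - κ * b| ^ p ≤ 2 * (|a| ^ q + |b| ^ q) ^ (p / q))
    (f g : F) :
    E (f + κ • g) + E (f - κ • g) ≤ 2 * (E f ^ (q / p) + E g ^ (q / p)) ^ (p / q) := by
  have hp0 : 0 < p := by linarith
  have h0 := hE.isEnergyForm.1
  set c : ℝ := (2⁻¹ : ℝ) ^ (1 / p) with hc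
  have hc0 : 0 ≤ c := by positivity
  have hcp : |c| ^ p = 2⁻¹ := by
    rw [abs_of_nonneg hc0, hc, ← Real.rpow_mul (by norm_num), one_div_mul_cancel hp0.ne',
      Real.rpow_one]
  let T : (Fin 2 → ℝ) → (Fin 2 → ℝ) := fun v => ![c * (v 0 + κ * v 1), c * (v 0 - κ * v 1)]
  obtain ⟨hT, hle⟩ := hE.contraction 2 2 (ENNReal.ofReal q) (ENNReal.ofReal p) two_pos two_pos
    (ENNReal.ofReal_pos.2 hq) (ENNReal.ofReal_le_ofReal hqp) le_rfl T
    (by ext i; fin_cases i <;> simp [T])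
    (fun x y => by
      have e : T x - T y = T (x - y) := by
        ext i
        fin_cases i <;> simp [T] <;> ring
      rw [e, norm_toLp_ofReal hp0, norm_toLp_ofReal hq]
      set z := x - y
      simp only [Fin.sum_univ_two, T, Matrix.cons_val_zero, Matrix.cons_val_one, abs_mul]
      rw [Real.mul_rpow (abs_nonneg _) (abs_nonneg _), Real.mul_rpow (abs_nonneg _) (abs_nonneg _),
        hcp, ← mul_add]
      have h1 := h (z 0) (z 1)
      calc _ ≤ ((|z 0| ^ q + |z 1| ^ q) ^ (p / q)) ^ (1 / p) :=
            Real.rpow_le_rpow (by positivity) (by linarith) (by positivity)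
        _ = _ := by
            rw [← Real.rpow_mul (by positivity)]
            congr 1
            field_simp)
    ![f, g]
  have e0 : (⟨_, hT 0⟩ : F) = c • (f + κ • g) := by
    ext x
    simp [T, mul_add]
  have e1 : (⟨_, hT 1⟩ : F) = c • (f - κ • g) := by
    ext x
    simp [T, mul_sub]
  rw [norm_toLp_ofReal hp0, norm_toLp_ofReal hq] at hle
  simp only [hE.energy_rpow hp, Fin.sum_univ_two, Matrix.cons_val_zero, Matrix.cons_val_one] at hle
  rw [e0, e1, hE.isEnergyForm.smul hp, hE.isEnergyForm.smul hp, hcp, ← mul_add] at hle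
  have hpow : ∀ u : F, |E u ^ (1 / p)| ^ q = E u ^ (q / p) := fun u => by
    rw [abs_of_nonneg (Real.rpow_nonneg (h0 u) _), ← Real.rpow_mul (h0 u)]
    ring_nf
  rw [hpow, hpow] at hle
  have hs : 0 ≤ E (f + κ • g) + E (f - κ • g) := add_nonneg (h0 _) (h0 _)
  have hr : 0 ≤ E f ^ (q / p) + E g ^ (q / p) :=
    add_nonneg (Real.rpow_nonneg (h0 f) _) (Real.rpow_nonneg (h0 g) _)
  have h3 := Real.rpow_le_rpow (by positivity) hle hp0.le
  rw [← Real.rpow_mul (by positivity), ← Real.rpow_mul hr, one_div_mul_cancel hp0.ne',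
    Real.rpow_one, one_div_mul_eq_div] at h3
  linarith

theorem IsResistanceForm.differentiableAt (hE : IsResistanceForm p E) (hp : 1 < p) (f g : F) :
    DifferentiableAt ℝ (fun t : ℝ => E (f + t • g)) 0 := by
  have hp0 : 0 < p := by linarith
  -- The choice is q = min(p, 2); q > 1 makes |t|^q negligible against t, and q ≤ p is required for
  -- the contraction property.
  obtain ⟨q, κ, hq, hqp, hκ, h⟩ : ∃ q κ : ℝ, 1 < q ∧ q ≤ p ∧ 0 < κ ∧ ∀ a b : ℝ,
      |a + κ * b| ^ p + |a - κ * b| ^ p ≤ 2 * (|a| ^ q + |b| ^ q) ^ (p / q) := by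
    rcases le_total p 2 with h2 | h2
    · refine ⟨p, 1, hp, le_rfl, one_pos, fun a b => ?_⟩
      rw [div_self hp0.ne', Real.rpow_one, one_mul]
      exact abs_add_rpow_add_abs_sub_rpow_le hp0 h2 a b
    · obtain ⟨κ, hκ, h⟩ := exists_abs_add_rpow_le h2
      exact ⟨2, κ, one_lt_two, h2, hκ, h⟩
  have hq0 : 0 < q := by linarith
  refine hE.isEnergyForm.differentiableAt_of_rpow hp (a := q / p) (b := p / q)
    (K := (|κ⁻¹| ^ p) ^ (q / p)) (by rwa [mul_div_cancel₀ _ hp0.ne']) ((one_le_div hq0).2 hqp)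
    (by field_simp) (fun f g => ?_) f g
  have h1 := hE.add_add_sub_le hp hq0 hqp h f (κ⁻¹ • g)
  rwa [smul_inv_smul₀ hκ.ne', hE.isEnergyForm.smul hp,
    Real.mul_rpow (by positivity) (hE.isEnergyForm.1 g)] at h1

theorem IsResistanceForm.abs_sub_rpow_le (hE : IsResistanceForm p E) (hp : 1 < p) (u : F)
    (x y : X) : |(u : X → ℝ) x - (u : X → ℝ) y| ^ p ≤ resistance p E x y * E u := by
  by_cases hu : ∃ c : ℝ, (u : X → ℝ) = fun _ => c
  · obtain ⟨c, hc⟩ := hu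
    rw [(hE.eq_zero_iff u).2 ⟨c, hc⟩, hc]
    simp [Real.zero_rpow (by linarith : p ≠ 0)]
  · have hpos : 0 < E u :=
      (hE.isEnergyForm.1 u).lt_of_ne fun h => hu ((hE.eq_zero_iff u).1 h.symm)
    rw [← div_le_iff₀ hpos]
    exact le_csSup (hE.resistance_finite x y) ⟨u, not_exists.1 hu, rfl⟩

theorem IsResistanceForm.resistance_nonneg (hE : IsResistanceForm p E) (x y : X) :
    0 ≤ resistance p E x y := by
  refine Real.sSup_nonneg ?_
  rintro r ⟨u, -, rfl⟩
  exact div_nonneg (Real.rpow_nonneg (abs_nonneg _) _) (hE.isEnergyForm.1 u)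

theorem IsResistanceForm.measurable (hE : IsResistanceForm p E) (hp : 1 < p) (u : F) :
    @Measurable X ℝ (resistanceBorel p E) _ (u : X → ℝ) := by
  have hp0 : 0 < p := by linarith
  let := resistanceBorel p E
  refine measurable_of_isOpen fun V hV => MeasurableSpace.measurableSet_generateFrom ?_
  intro x hx
  obtain ⟨δ, hδ, hball⟩ := Metric.isOpen_iff.1 hV _ hx
  have h0 := hE.isEnergyForm.1 u
  have hE0 : 0 < E u ^ (1 / p) + 1 := by positivity
  -- Continuity follows from |u(x) - u(y)| ≤ R(x, y)^(1/p) E(u)^(1/p); the summand 1 covers constant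
  -- u.
  refine ⟨δ / (E u ^ (1 / p) + 1), by positivity, fun y hy => hball ?_⟩
  rw [Metric.mem_ball, dist_comm, Real.dist_eq]
  have hR := hE.resistance_nonneg x y
  have h1 := Real.rpow_le_rpow (by positivity) (hE.abs_sub_rpow_le hp u x y)
    (by positivity : 0 ≤ 1 / p)
  rw [← Real.rpow_mul (abs_nonneg _), mul_one_div_cancel hp0.ne', Real.rpow_one,
    Real.mul_rpow hR h0] at h1
  rw [lt_div_iff₀ hE0] at hy
  have h2 : 0 ≤ resistance p E x y ^ (1 / p) := by positivity
  nlinarith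

end ResistanceForm

/-! ### The logarithmic Caccioppoli inequality -/

section LogCaccioppoli

variable {X : Type*} [MeasurableSpace X] {F : Submodule ℝ (X → ℝ)} {p : ℝ} {E : F → ℝ}
  {Γ : F → Measure X}

theorem hasFDerivAt_abs_rpow_mul_exp (hp : 1 < p) (y : Fin 2 → ℝ) :
    HasFDerivAt (fun y : Fin 2 → ℝ => |y 1| ^ p * Real.exp ((1 - p) * y 0))
      (|y 1| ^ p • (Real.exp ((1 - p) * y 0) •
          (1 - p) • ContinuousLinearMap.proj (R := ℝ) (φ := fun _ : Fin 2 => ℝ) 0) +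
        Real.exp ((1 - p) * y 0) • ((p * |y 1| ^ (p - 2) * y 1) •
          ContinuousLinearMap.proj (R := ℝ) (φ := fun _ : Fin 2 => ℝ) 1)) y := by
  have h1 : HasFDerivAt (fun y : Fin 2 → ℝ => |y 1| ^ p)
      ((p * |y 1| ^ (p - 2) * y 1) •
        ContinuousLinearMap.proj (R := ℝ) (φ := fun _ : Fin 2 => ℝ) 1) y :=
    (hasDerivAt_abs_rpow (y 1) hp).comp_hasFDerivAt (h₂ := fun t : ℝ => |t| ^ p)
      (f := fun y : Fin 2 → ℝ => y 1) y (hasFDerivAt_apply 1 y)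
  have h2 : HasFDerivAt (fun y : Fin 2 → ℝ => (1 - p) * y 0)
      ((1 - p) • ContinuousLinearMap.proj (R := ℝ) (φ := fun _ : Fin 2 => ℝ) 0) y :=
    (hasFDerivAt_apply 0 y).const_mul (1 - p)
  exact h1.mul h2.exp

/-- The absolute value makes the outer function C¹ on all of ℝ², as the chain rule demands; it
disappears once φ ≥ 0 is inserted. -/
theorem contDiff_abs_rpow_mul_exp (hp : 1 < p) :
    ContDiff ℝ 1 (fun y : Fin 2 → ℝ => |y 1| ^ p * Real.exp ((1 - p) * y 0)) := by
  have h1 : ContDiff ℝ 1 (fun t : ℝ => |t| ^ p) := by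
    simpa only [Real.norm_eq_abs] using contDiff_norm_rpow (E := ℝ) hp
  exact (h1.comp (contDiff_apply ℝ ℝ 1)).mul (contDiff_const.mul (contDiff_apply ℝ ℝ 0)).exp

theorem rpow_sub_two_mul_self {t : ℝ} (ht : 0 ≤ t) (hp : 1 < p) :
    t ^ (p - 2) * t = t ^ (p - 1) := by
  rcases ht.eq_or_lt with rfl | ht
  · rw [mul_zero, Real.zero_rpow (by linarith)]
  · rw [← Real.rpow_add_one ht.ne']
    ring_nf

/-- The chain rule applied to `exp(l)` and the logarithmic test function
`φ ^ p * exp((1 - p) l)`. -/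
theorem ChainRule.exists_logTest (hch : ChainRule p Γ) (hΓ : IsEnergyMeasureFamily p E Γ)
    (hC : MeasureClarkson p Γ) (hp : 1 < p) (l φ : F) (h0 : ∀ x, 0 ≤ (φ : X → ℝ) x) :
    ∃ w ψ : F, (∀ x, (w : X → ℝ) x = Real.exp ((l : X → ℝ) x)) ∧
      (∀ x, (ψ : X → ℝ) x = (φ : X → ℝ) x ^ p * Real.exp ((1 - p) * (l : X → ℝ) x)) ∧
      crossForm p (fun f => (Γ f).real univ) w ψ =
        (1 - p) * ∫ x, (φ : X → ℝ) x ^ p ∂(Γ l) +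
          p * ∫ᵛ x, (φ : X → ℝ) x ^ (p - 1) ∂•(mutualMeasure p Γ l φ) := by
  obtain ⟨hw, hψ, h⟩ := hch 2 two_pos l ![l, φ] Real.exp
    (fun y => |y 1| ^ p * Real.exp ((1 - p) * y 0)) Real.contDiff_exp
    (contDiff_abs_rpow_mul_exp hp)
  refine ⟨⟨_, hw⟩, ⟨_, hψ⟩, fun _ => rfl, fun x => ?_, ?_⟩
  · simp [abs_of_nonneg (h0 x)]
  have h1 := h univ MeasurableSet.univ
  rw [hΓ.mutualMeasure_apply hC hp _ _ MeasurableSet.univ] at h1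
  rw [h1]
  simp only [VectorMeasure.restrict_univ, Fin.sum_univ_two, Matrix.cons_val_zero,
    Matrix.cons_val_one, Real.deriv_exp, Real.sign_of_pos (Real.exp_pos _), one_mul, Real.abs_exp,
    (hasFDerivAt_abs_rpow_mul_exp hp _).fderiv]
  -- The exponent 1 - p in the test function is chosen to cancel the weight |Φ'(l)|^(p - 1) produced
  -- by Φ = exp.
  have hexp : ∀ x, Real.exp ((l : X → ℝ) x) ^ (p - 1) * Real.exp ((1 - p) * (l : X → ℝ) x) = 1 := by
    intro x
    rw [← Real.exp_mul, ← Real.exp_add, ← Real.exp_zero]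
    ring_nf
  rw [← hΓ.integral_mutualMeasure_self hC hp, ← smul_eq_mul (1 - p), ← smul_eq_mul p,
    ← VectorMeasure.integral_fun_smul, ← VectorMeasure.integral_fun_smul]
  congr 2
  · ext x
    have := hexp x
    simp [abs_of_nonneg (h0 x)]
    linear_combination (φ : X → ℝ) x ^ p * (1 - p) * this
  · ext x
    have := hexp x
    have h2 := rpow_sub_two_mul_self (h0 x) hp
    simp [abs_of_nonneg (h0 x)]
    rw [← h2]
    linear_combination (p * (φ : X → ℝ) x ^ (p - 2) * (φ : X → ℝ) x) * this

/-- The logarithmic Caccioppoli inequality for non-negative superharmonic functions. -/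
theorem integral_log_le (hE : IsResistanceForm p E) (hΓ : IsEnergyMeasureFamily p E Γ)
    (hC : MeasureClarkson p Γ) (hp : 1 < p) (hch : ChainRule p Γ)
    (hmeas : ∀ f : F, Measurable (f : X → ℝ)) {U : Set X} {u l φ : F} {ε : ℝ} (hε : 0 < ε)
    (hu : ∀ x, 0 ≤ (u : X → ℝ) x) (hsup : IsSuperharmonicOn p E u U)
    (hmass : Γ u univ = ENNReal.ofReal (E u))
    (hl : ∀ x, (l : X → ℝ) x = Real.log ((u : X → ℝ) x + ε))
    (h0 : ∀ x, 0 ≤ (φ : X → ℝ) x) (h1 : ∀ x, (φ : X → ℝ) x ≤ 1)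
    (hφU : ∀ x, x ∉ U → (φ : X → ℝ) x = 0) :
    ∫ x, (φ : X → ℝ) x ^ p ∂(Γ l) ≤ 2 ^ p / (p - 1) * E φ := by
  have hp1 : 0 < p - 1 := by linarith
  obtain ⟨w, ψ, hw, hψ, hcross⟩ := hch.exists_logTest hΓ hC hp l φ h0
  have hform := hΓ.isEnergyForm univ MeasurableSet.univ
  have hle : ∀ f, (Γ f).real univ ≤ E f := fun f =>
    ENNReal.toReal_le_of_le_ofReal (hE.isEnergyForm.1 f) (hΓ.dominated f)
  let c : F := ⟨_, hE.const_mem ε⟩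
  have hc : (Γ c).real univ = 0 := by
    refine le_antisymm ((hle c).trans_eq ?_) measureReal_nonneg
    exact (hE.eq_zero_iff c).2 ⟨ε, rfl⟩
  have hwu : w = u + c := by
    ext x
    rw [hw, hl, Real.exp_log (add_pos_of_nonneg_of_pos (hu x) hε)]
    rfl
  have hneg : crossForm p E (-u) ψ ≤ 0 := by
    refine hsup ψ (fun x hx => ?_) fun x => ?_
    · rw [hψ, hφU x hx, Real.zero_rpow (by linarith), zero_mul]
    · rw [hψ]
      exact mul_nonneg (Real.rpow_nonneg (h0 x) _) (Real.exp_pos _).le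
  have hmass' : (Γ (-u)).real univ = E (-u) := by
    have h2 : (Γ (-u)).real univ = (Γ u).real univ := hform.neg hp u
    rw [h2, hE.isEnergyForm.neg hp, Measure.real, hmass,
      ENNReal.toReal_ofReal (hE.isEnergyForm.1 u)]
  -- The full-mass hypothesis enters here: it transfers the superharmonicity inequality from E to Γ.
  have heq : crossForm p (fun f => (Γ f).real univ) (-u) ψ = crossForm p E (-u) ψ :=
    crossForm_eq_of_le hle hmass' (hΓ.differentiableAt hC hp MeasurableSet.univ _ _)
      (hE.differentiableAt hp _ _)
  rw [← heq, crossForm_neg_left hform hp] at hneg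
  rw [hwu, crossForm_add_left_of_eq_zero hform hp hc] at hcross
  have hY := hΓ.integral_mutualMeasure_le hC hp l φ (hmeas φ) h0 h1
  set I := ∫ x, (φ : X → ℝ) x ^ p ∂(Γ l)
  have h2 : (2 : ℝ) ^ (p - 1) * (Γ φ).real univ ≤ 2 ^ (p - 1) * E φ :=
    mul_le_mul_of_nonneg_left (hle φ) (by positivity)
  have h3 : (2 : ℝ) ^ p = 2 * 2 ^ (p - 1) := by
    rw [Real.rpow_sub_one two_ne_zero]
    ring
  rw [h3, div_mul_eq_mul_div, le_div_iff₀ hp1]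
  linarith

/-- Enlarging B to the measurable level set {φ = 1} avoids any measurability assumption on B. -/
theorem measure_le_ofReal_integral_rpow {μ : Measure X} [IsFiniteMeasure μ] {φ : X → ℝ}
    (hφ : Measurable φ) (hp : 0 ≤ p) (h0 : ∀ x, 0 ≤ φ x) (h1 : ∀ x, φ x ≤ 1) {B : Set X}
    (hB : ∀ x ∈ B, φ x = 1) : μ B ≤ ENNReal.ofReal (∫ x, φ x ^ p ∂μ) := by
  have hint : Integrable (fun x => φ x ^ p) μ := by
    refine Integrable.of_bound (hφ.pow_const p).aestronglyMeasurable 1 (ae_of_all _ fun x => ?_)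
    rw [Real.norm_of_nonneg (Real.rpow_nonneg (h0 x) _)]
    exact Real.rpow_le_one (h0 x) (h1 x) hp
  rw [ofReal_integral_eq_lintegral_ofReal hint
    (ae_of_all _ fun x => Real.rpow_nonneg (h0 x) _)]
  have hS : MeasurableSet {x | φ x = 1} := measurableSet_eq_fun hφ measurable_const
  calc μ B ≤ μ {x | φ x = 1} := measure_mono hB
    _ = ∫⁻ x, {x | φ x = 1}.indicator 1 x ∂μ := (lintegral_indicator_one hS).symm
    _ ≤ _ := lintegral_mono fun x => by
        by_cases hx : φ x = 1
        · simp [hx]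
        · simp [hx]

end LogCaccioppoli

/-! ### Cutoff functions and the Harnack inequality -/

section Harnack

variable {X : Type*} {F : Submodule ℝ (X → ℝ)} {p : ℝ} {E : F → ℝ}

/-- A cutoff function with values in `[0, 1]` and controlled energy. -/
theorem IsResistanceForm.exists_cutoff (hE : IsResistanceForm p E) (hp : 1 < p) {x : X}
    {s r K : ℝ} (hcap : ballCapacity p E x s r < ENNReal.ofReal K) :
    ∃ φ : F, (∀ y, 0 ≤ (φ : X → ℝ) y) ∧ (∀ y, (φ : X → ℝ) y ≤ 1) ∧
      (∀ y ∈ resistanceBall p E x s, (φ : X → ℝ) y = 1) ∧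
      (∀ y, y ∉ resistanceBall p E x r → (φ : X → ℝ) y = 0) ∧ E φ ≤ K := by
  simp only [ballCapacity, iInf_lt_iff] at hcap
  obtain ⟨φ, ⟨hφ1, hφs⟩, hφK⟩ := hcap
  -- A near-minimizer of the capacity need not take values in [0, 1]; truncation keeps its values 0
  -- and 1 and does not raise its energy.
  obtain ⟨v, hv, hvE⟩ := hE.exists_truncation hp φ
  have hφK' : E φ ≤ K := by
    by_contra! h
    exact absurd hφK (ENNReal.ofReal_le_ofReal h.le).not_gt
  refine ⟨v, fun y => ?_, fun y => ?_, fun y hy => ?_, fun y hy => ?_, hvE.trans hφK'⟩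
  · rw [hv]
    exact le_min (le_max_right _ _) zero_le_one
  · rw [hv]
    exact min_le_right _ _
  · rw [hv, hφ1 y hy]
    simp
  · have : (φ : X → ℝ) y = 0 := by
      by_contra hne
      exact hy (hφs (@subset_closure X (resistanceTopology p E) _ _ hne))
    rw [hv, this]
    simp

theorem resistanceBall_mono (x : X) {s r : ℝ} (h : s ≤ r) :
    resistanceBall p E x s ⊆ resistanceBall p E x r :=
  fun _ hy => lt_of_lt_of_le hy h

theorem doubling_iterate {Υ : X → ℝ → ℝ} {C : ℝ} (hC : 0 < C)
    (hd : ∀ (x : X) (s : ℝ), 0 < s → Υ x (2 * s) ≤ C * Υ x s) (k : ℕ) (x : X) {s : ℝ}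
    (hs : 0 < s) : Υ x (2 ^ k * s) ≤ C ^ k * Υ x s := by
  induction k with
  | zero => simp
  | succ k ih =>
    calc Υ x (2 ^ (k + 1) * s) = Υ x (2 * (2 ^ k * s)) := by ring_nf
      _ ≤ C * Υ x (2 ^ k * s) := hd x _ (by positivity)
      _ ≤ C * (C ^ k * Υ x s) := by gcongr
      _ = _ := by ring

theorem le_exp_mul_of_abs_log_sub_le {a b K : ℝ} (ha : 0 < a) (hb : 0 < b)
    (h : |Real.log a - Real.log b| ≤ K) : a ≤ Real.exp K * b := by
  have h1 : Real.log a ≤ K + Real.log b := by linarith [le_abs_self (Real.log a - Real.log b)]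
  calc a = Real.exp (Real.log a) := (Real.exp_log ha).symm
    _ ≤ Real.exp (K + Real.log b) := Real.exp_le_exp.2 h1
    _ = _ := by rw [Real.exp_add, Real.exp_log hb]

theorem iSup_le_mul_iInf_ereal {B : Set X} {u : X → ℝ} {K : ℝ} (hK : 0 < K)
    (h : ∀ y ∈ B, ∀ z ∈ B, u y ≤ K * u z) :
    (⨆ y ∈ B, ((u y : ℝ) : EReal)) ≤ (K : EReal) * ⨅ y ∈ B, ((u y : ℝ) : EReal) := by
  have hK' : (0 : EReal) < K := EReal.coe_pos.2 hK
  rw [← EReal.div_le_iff_le_mul hK' (EReal.coe_ne_top K)]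
  refine le_iInf₂ fun z hz => ?_
  rw [EReal.div_le_iff_le_mul hK' (EReal.coe_ne_top K)]
  refine iSup₂_le fun y hy => ?_
  rw [← EReal.coe_mul]
  exact EReal.coe_le_coe_iff.2 (h y hy z hz)

end Harnack

end PResistance

theorem theorem6p28 {X : Type*} [Nonempty X] (p : ℝ) (hp : 1 < p)
    (F : Submodule ℝ (X → ℝ)) (E : F → ℝ) (hE : PResistance.IsResistanceForm p E)
    (Γ : F → @Measure X (PResistance.resistanceBorel p E))
    (hΓ : PResistance.IsEnergyMeasureFamily p E Γ)
    (hCla : PResistance.MeasureClarkson p Γ)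
    (Υ : X → ℝ → ℝ) (hΥ : ∀ (x : X) (s : ℝ), 0 < s → 0 < Υ x s)
    (A₁ A₂ C : ℝ) (hA₁ : 1 ≤ A₁) (hA₂ : 1 < A₂) (hC : 0 < C)
    (doubling : ∀ (x : X) (s : ℝ), 0 < s → Υ x (2 * s) ≤ C * Υ x s)
    (twoPoint : ∀ (x : X) (s : ℝ), 0 < s → ∀ u : F,
      (⨆ y ∈ PResistance.resistanceBall p E x s, ⨆ z ∈ PResistance.resistanceBall p E x s,
          ENNReal.ofReal (|(u : X → ℝ) y - (u : X → ℝ) z| ^ p))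
        ≤ ENNReal.ofReal (C * (Υ x s)⁻¹) * Γ u (PResistance.resistanceBall p E x (A₁ * s)))
    (capacityUpper : ∀ (x : X) (s : ℝ), 0 < s →
      PResistance.resistanceBall p E x (A₂ * s) ≠ Set.univ →
      PResistance.ballCapacity p E x s (A₂ * s) ≤ ENNReal.ofReal (C * Υ x s))
    (chainRule : PResistance.ChainRule p Γ) :
    ∃ C_H δ_H : ℝ, 0 < C_H ∧ 0 < δ_H ∧ δ_H < 1 ∧
      ∀ (x : X) (s : ℝ), 0 < s →
        PResistance.resistanceBall p E x (δ_H⁻¹ * s) ≠ Set.univ →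
        ∀ u : F, (∀ y, 0 ≤ (u : X → ℝ) y) →
          PResistance.IsSuperharmonicOn p E u (PResistance.resistanceBall p E x (δ_H⁻¹ * s)) →
          Γ u Set.univ = ENNReal.ofReal (E u) →
          (⨆ y ∈ PResistance.resistanceBall p E x s, (((u : X → ℝ) y : ℝ) : EReal))
            ≤ (C_H : EReal) *
              (⨅ y ∈ PResistance.resistanceBall p E x s, (((u : X → ℝ) y : ℝ) : EReal)) := by
  let := PResistance.resistanceBorel p E
  have hp0 : 0 < p := by linarith
  have hp1 : 0 < p - 1 := by linarith
  -- The cutoff must equal 1 on B(x, A₁ s), where the two-point estimate sees the energy; a dyadic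
  -- radius 2^k s lets doubling compare Υ at that scale with Υ(x, s).
  obtain ⟨k, hk⟩ := pow_unbounded_of_one_lt A₁ one_lt_two
  have h2k : (1 : ℝ) ≤ 2 ^ k := one_le_pow₀ one_le_two
  -- The factors come from the two-point estimate, the Caccioppoli inequality, and the cutoff energy
  -- (capacity and doubling constants); the extra 2 gives the strict inequality needed to pick a
  -- cutoff without an attained infimum.
  set M : ℝ := C * (2 ^ p / (p - 1) * (2 * (C * C ^ k))) with hM
  have hM0 : 0 < M := by positivity
  refine ⟨Real.exp (M ^ (1 / p)), (A₂ * 2 ^ k)⁻¹, Real.exp_pos _, by positivity,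
    inv_lt_one_of_one_lt₀ (one_lt_mul_of_lt_of_le hA₂ h2k), fun x s hs hne u hu hsup hmass => ?_⟩
  rw [inv_inv, mul_assoc] at hne hsup
  have hks : 0 < 2 ^ k * s := by positivity
  have hΥs := hΥ x s hs
  have hcap : PResistance.ballCapacity p E x (2 ^ k * s) (A₂ * (2 ^ k * s)) <
      ENNReal.ofReal (2 * (C * C ^ k) * Υ x s) := by
    refine (capacityUpper x _ hks hne).trans_lt ?_
    rw [ENNReal.ofReal_lt_ofReal_iff (by positivity)]
    have h1 := mul_le_mul_of_nonneg_left (PResistance.doubling_iterate hC doubling k x hs) hC.le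
    have h2 : 0 < C * C ^ k * Υ x s := by positivity
    linarith
  obtain ⟨φ, h0, h1, hφB, hφU, hφE⟩ := hE.exists_cutoff hp hcap
  refine PResistance.iSup_le_mul_iInf_ereal (Real.exp_pos _) fun y hy z hz => ?_
  have key : ∀ ε : ℝ, 0 < ε →
      (u : X → ℝ) y + ε ≤ Real.exp (M ^ (1 / p)) * ((u : X → ℝ) z + ε) := by
    intro ε hε
    obtain ⟨l, hl⟩ := hE.exists_log hp u hu hε
    have hI := PResistance.integral_log_le hE hΓ hCla hp chainRule (hE.measurable hp) hε hu hsup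
      hmass hl h0 h1 hφU
    have := hΓ.isFiniteMeasure l
    have hball : Γ l (PResistance.resistanceBall p E x (A₁ * s)) ≤
        ENNReal.ofReal (2 ^ p / (p - 1) * (2 * (C * C ^ k) * Υ x s)) := by
      refine (measure_mono (PResistance.resistanceBall_mono x
        (mul_le_mul_of_nonneg_right hk.le hs.le))).trans ?_
      refine (PResistance.measure_le_ofReal_integral_rpow (hE.measurable hp φ) hp0.le h0 h1
        hφB).trans (ENNReal.ofReal_le_ofReal (hI.trans ?_))
      exact mul_le_mul_of_nonneg_left hφE (by positivity)
    have h2 : ENNReal.ofReal (|(l : X → ℝ) y - (l : X → ℝ) z| ^ p) ≤ ENNReal.ofReal M := by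
      refine ((le_iSup₂ (f := fun z _ => ENNReal.ofReal (|(l : X → ℝ) y - (l : X → ℝ) z| ^ p))
        z hz).trans (le_iSup₂ (f := fun y _ =>
          ⨆ z ∈ PResistance.resistanceBall p E x s,
            ENNReal.ofReal (|(l : X → ℝ) y - (l : X → ℝ) z| ^ p)) y hy)).trans
        ((twoPoint x s hs l).trans ((mul_le_mul_right hball _).trans_eq ?_))
      -- Υ(x, s)⁻¹ from the two-point estimate cancels Υ(x, s) from the cutoff energy.
      rw [← ENNReal.ofReal_mul (by positivity), hM]
      congr 1
      field_simp
    rw [ENNReal.ofReal_le_ofReal_iff hM0.le, hl, hl] at h2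
    refine PResistance.le_exp_mul_of_abs_log_sub_le (add_pos_of_nonneg_of_pos (hu y) hε)
      (add_pos_of_nonneg_of_pos (hu z) hε) ?_
    rwa [one_div, Real.le_rpow_inv_iff_of_pos (abs_nonneg _) hM0.le hp0]
  -- M does not depend on ε, so ε ↓ 0 also covers points where u vanishes.
  have hlim : Filter.Tendsto (fun ε : ℝ => Real.exp (M ^ (1 / p)) * ((u : X → ℝ) z + ε))
      (nhdsWithin 0 (Set.Ioi 0)) (nhds (Real.exp (M ^ (1 / p)) * ((u : X → ℝ) z + 0))) :=
    ((continuous_const.mul (continuous_const.add continuous_id)).tendsto 0).mono_left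
      nhdsWithin_le_nhds
  rw [add_zero] at hlim
  refine ge_of_tendsto hlim ?_
  filter_upwards [self_mem_nhdsWithin] with ε hε
  have hε' : (0 : ℝ) < ε := hε
  linarith [key ε hε']
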